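/- Work in Aczel's constructive Zermelo--Fraenkel set theory $\mathbf{CZF}$ (intuitionistic first-order logic with equality; axioms: extensionality, pairing, union, infinity, set induction, bounded separation, strong collection, subset collection). A \emph{rule} on a set $X$ is a pair $(a,b)$ of subsets of $X$; for a set $\mathcal R$ of rules on $X$, a subset $Y\subseteq X$ is \emph{$\mathcal R$-closed} if for all $(a,b)\in\mathcal R$ with $a\subseteq Y$ the set $b\cap Y$ is inhabited. A class $M$ of subsets of a set is \emph{set-generated} if there is a set $G\subseteq M$ such that for all $\alpha\in M$ and $a\in\alpha$ there is $\beta\in G$ with $a\in\beta\subseteq\alpha$. The principle $\mathrm{NID}$ says: for every set $X$ and every set $\mathcal R$ of rules on $X$, the class of $\mathcal R$-closed subsets of $X$ is set-generated. Let $\mathbb P$ be a preordered set. A \emph{sieve} on $a\in\mathbb P$ is a downwards closed subset of $\{x\in\mathbb P: x\le a\}$. A \emph{formal space} $(\mathbb P,\mathrm{Cov})$ is a preordered set $\mathbb P$ with a class $\mathrm{Cov}(a)$ of sieves on $a$ for every $a\in\mathbb P$, such that (i) $\{x\in\mathbb P: x\le a\}\in\mathrm{Cov}(a)$; (ii) if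 $S\in\mathrm{Cov}(a)$ and $b\le a$, then $\{x\in S:x\le b\}\in\mathrm{Cov}(b)$; (iii) if $S$ is a sieve on $a$, $R\in\mathrm{Cov}(a)$ and $\{x\in S:x\le b\}\in\mathrm{Cov}(b)$ for all $b\in R$, then $S\in\mathrm{Cov}(a)$. It is \emph{set-presented} if there is a function $\mathrm{BCov}$ assigning to every $a\in\mathbb P$ a set $\mathrm{BCov}(a)$ of subsets of $\mathbb P$ such that, for all $a\in\mathbb P$ and all sieves $S$ on $a$, $S\in\mathrm{Cov}(a)$ if and only if $R\subseteq S$ for some $R\in\mathrm{BCov}(a)$. A \emph{morphism} (continuous map) $F:(\mathbb P,\mathrm{Cov})\to(\mathbb Q,\mathrm{Cov}')$ is a subset $F\subseteq\mathbb P\times\mathbb Q$ such that: (1) if $F(p,q)$, $p'\le p$ and $q\le q'$, then $F(p',q')$; (2) if $S\in\mathrm{Cov}(p)$ and $F(p',q)$ for all $p'\in S$, then $F(p,q)$; (3) for every $p\in\mathbb P$ there is $S\in\mathrm{Cov}(p)$ such that every $p'\in S$ is related via $F$ to some $q'\in\mathbb Q$; (4) if $F(p,q_0)$ and $F(p,q_1)$,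 then there is $S\in\mathrm{Cov}(p)$ such that every $p'\in S$ is related via $F$ to some $q'\in\mathbb Q$ with $q'\le q_0$ and $q'\le q_1$; (5) if $F(p,q)$ and $T\in\mathrm{Cov}'(q)$, then there is $S\in\mathrm{Cov}(p)$ such that every $p'\in S$ is related via $F$ to some $q'\in T$. \textbf{Theorem.} $\mathbf{CZF}$ proves: $\mathrm{NID}$ implies that for any two set-presented formal spaces $(\mathbb P,\mathrm{Cov})$ and $(\mathbb Q,\mathrm{Cov}')$ the class of morphisms from $(\mathbb P,\mathrm{Cov})$ to $(\mathbb Q,\mathrm{Cov}')$ is set-generated. (As $\mathrm{Cov}$ and $\mathrm{Cov}'$ may be proper classes, this is a schema: it is asserted for all formulas of the language of set theory, possibly with parameters, that define $\mathrm{Cov}$ and $\mathrm{Cov}'$.) -/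

import Mathlib

namespace CZF

/-- Formulas of first-order logic in the language of set theory with equality. All intuitionistic
connectives are primitive. Variables are de Bruijn indices: under a quantifier, the variable `0` is
the bound one and `n + 1` is the variable that is called `n` outside. The language has no function
symbols, so that the only terms are variables. -/
inductive Fm : Type
  | mem (x y : ℕ) : Fm
  | eq (x y : ℕ) : Fm
  | bot : Fm
  | and (φ ψ : Fm) : Fm
  | or (φ ψ : Fm) : Fm
  | imp (φ ψ : Fm) : Fm
  | all (φ : Fm) : Fm
  | ex (φ : Fm) : Fm

infix:50 " ∈ˢ " => Fm.mem
infix:50 " =ˢ " => Fm.eq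
infixr:35 " ∧ˢ " => Fm.and
infixr:30 " ∨ˢ " => Fm.or
infixr:25 " →ˢ " => Fm.imp

/-- Equivalence of formulas. -/
def Fm.iff (φ ψ : Fm) : Fm := (φ →ˢ ψ) ∧ˢ (ψ →ˢ φ)

infix:20 " ↔ˢ " => Fm.iff

/-- The renaming of variables that is used under a quantifier. -/
def liftRen (ρ : ℕ → ℕ) : ℕ → ℕ
  | 0 => 0
  | n + 1 => ρ n + 1

/-- Simultaneous capture-avoiding substitution of variables for the free variables. -/
def Fm.ren : (ℕ → ℕ) → Fm → Fm
  | ρ, .mem x y => .mem (ρ x) (ρ y)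
  | ρ, .eq x y => .eq (ρ x) (ρ y)
  | _, .bot => .bot
  | ρ, .and φ ψ => .and (φ.ren ρ) (ψ.ren ρ)
  | ρ, .or φ ψ => .or (φ.ren ρ) (ψ.ren ρ)
  | ρ, .imp φ ψ => .imp (φ.ren ρ) (ψ.ren ρ)
  | ρ, .all φ => .all (φ.ren (liftRen ρ))
  | ρ, .ex φ => .ex (φ.ren (liftRen ρ))

/-- Weakening of a formula by a fresh variable `0`. -/
def Fm.shift (φ : Fm) : Fm := φ.ren Nat.succ

/-- The formula `φ(t)` for the body `φ` of a quantified formula and a variable `t`. -/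
def Fm.inst (φ : Fm) (t : ℕ) : Fm :=
  φ.ren fun
    | 0 => t
    | n + 1 => n

/-- Natural deduction for intuitionistic first-order logic with equality. `Provable T Γ φ` says
that `φ` is derivable from the axioms in `T` and the hypotheses in `Γ`. Free variables of axioms
stand for arbitrary sets (an axiom is read as its universal closure), while free variables of
hypotheses are fixed, whence the weakening of the hypotheses in `allI` and `exE`. -/
inductive Provable (T : Set Fm) : List Fm → Fm → Prop
  | ax {Γ : List Fm} {φ : Fm} : φ ∈ T → Provable T Γ φ
  | hyp {Γ : List Fm} {φ : Fm} : φ ∈ Γ → Provable T Γ φ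
  | botE {Γ : List Fm} {φ : Fm} : Provable T Γ Fm.bot → Provable T Γ φ
  | andI {Γ : List Fm} {φ ψ : Fm} :
      Provable T Γ φ → Provable T Γ ψ → Provable T Γ (φ ∧ˢ ψ)
  | andE₁ {Γ : List Fm} {φ ψ : Fm} : Provable T Γ (φ ∧ˢ ψ) → Provable T Γ φ
  | andE₂ {Γ : List Fm} {φ ψ : Fm} : Provable T Γ (φ ∧ˢ ψ) → Provable T Γ ψ
  | orI₁ {Γ : List Fm} {φ ψ : Fm} : Provable T Γ φ → Provable T Γ (φ ∨ˢ ψ)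
  | orI₂ {Γ : List Fm} {φ ψ : Fm} : Provable T Γ ψ → Provable T Γ (φ ∨ˢ ψ)
  | orE {Γ : List Fm} {φ ψ χ : Fm} : Provable T Γ (φ ∨ˢ ψ) →
      Provable T (φ :: Γ) χ → Provable T (ψ :: Γ) χ → Provable T Γ χ
  | impI {Γ : List Fm} {φ ψ : Fm} : Provable T (φ :: Γ) ψ → Provable T Γ (φ →ˢ ψ)
  | impE {Γ : List Fm} {φ ψ : Fm} :
      Provable T Γ (φ →ˢ ψ) → Provable T Γ φ → Provable T Γ ψ
  | allI {Γ : List Fm} {φ : Fm} : Provable T (Γ.map Fm.shift) φ → Provable T Γ (Fm.all φ)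
  | allE {Γ : List Fm} {φ : Fm} (t : ℕ) : Provable T Γ (Fm.all φ) → Provable T Γ (φ.inst t)
  | exI {Γ : List Fm} {φ : Fm} (t : ℕ) : Provable T Γ (φ.inst t) → Provable T Γ (Fm.ex φ)
  | exE {Γ : List Fm} {φ ψ : Fm} : Provable T Γ (Fm.ex φ) →
      Provable T (φ :: Γ.map Fm.shift) ψ.shift → Provable T Γ ψ
  | eqI {Γ : List Fm} (t : ℕ) : Provable T Γ (t =ˢ t)
  | eqE {Γ : List Fm} {s t : ℕ} (φ : Fm) :
      Provable T Γ (s =ˢ t) → Provable T Γ (φ.inst s) → Provable T Γ (φ.inst t)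

/-! Classes. A formula `φ` is used as a class by reading its variable `0` (its variables `0, 1`, or
`0, 1, 2`) as the argument(s), and its other variables as parameters. If the parameters are taken
from the variables outside of `d` quantifiers, then the instances of `φ` under these quantifiers
are the following. -/

/-- `φ(x)` under `d` quantifiers. -/
def Fm.app₁ (φ : Fm) (d x : ℕ) : Fm :=
  φ.ren fun
    | 0 => x
    | n + 1 => n + d

/-- `φ(x, y)` under `d` quantifiers. -/
def Fm.app₂ (φ : Fm) (d x y : ℕ) : Fm :=
  φ.ren fun
    | 0 => x
    | 1 => y
    | n + 2 => n + d

/-- `φ(x, y, z)` under `d` quantifiers. -/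
def Fm.app₃ (φ : Fm) (d x y z : ℕ) : Fm :=
  φ.ren fun
    | 0 => x
    | 1 => y
    | 2 => z
    | n + 3 => n + d

/-- `∀ v ∈ x, φ(v)`. -/
def ball (x : ℕ) (φ : Fm) : Fm := .all (0 ∈ˢ x + 1 →ˢ φ)

/-- `∃ v ∈ x, φ(v)`. -/
def bex (x : ℕ) (φ : Fm) : Fm := .ex (0 ∈ˢ x + 1 ∧ˢ φ)

/-- Bounded formulas: all quantifiers are of the form `∀ v ∈ x` or `∃ v ∈ x`. -/
inductive Bounded : Fm → Prop
  | mem (x y : ℕ) : Bounded (x ∈ˢ y)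
  | eq (x y : ℕ) : Bounded (x =ˢ y)
  | bot : Bounded Fm.bot
  | and {φ ψ : Fm} : Bounded φ → Bounded ψ → Bounded (φ ∧ˢ ψ)
  | or {φ ψ : Fm} : Bounded φ → Bounded ψ → Bounded (φ ∨ˢ ψ)
  | imp {φ ψ : Fm} : Bounded φ → Bounded ψ → Bounded (φ →ˢ ψ)
  | ball (x : ℕ) {φ : Fm} : Bounded φ → Bounded (ball x φ)
  | bex (x : ℕ) {φ : Fm} : Bounded φ → Bounded (bex x φ)

/-! ### Elementary set-theoretic notions -/

/-- `x ⊆ y`. -/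
def sub (x y : ℕ) : Fm := ball x (0 ∈ˢ y + 1)

/-- `x = ∅`. -/
def isEmpty (x : ℕ) : Fm := ball x .bot

/-- `x = y ∪ {y}`. -/
def isSucc (x y : ℕ) : Fm := .all (0 ∈ˢ x + 1 ↔ˢ 0 ∈ˢ y + 1 ∨ˢ 0 =ˢ y + 1)

/-- `z = {a, b}`. -/
def isUPair (z a b : ℕ) : Fm := a ∈ˢ z ∧ˢ b ∈ˢ z ∧ˢ ball z (0 =ˢ a + 1 ∨ˢ 0 =ˢ b + 1)

/-- `z = (a, b) = {{a}, {a, b}}`. -/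
def isOPair (z a b : ℕ) : Fm :=
  bex z (bex (z + 1)
    (isUPair 1 (a + 2) (a + 2) ∧ˢ isUPair 0 (a + 2) (b + 2) ∧ˢ isUPair (z + 2) 1 0))

/-- `(a, b) ∈ r`. -/
def rel (r a b : ℕ) : Fm := bex r (isOPair 0 (a + 1) (b + 1))

/-- `f` is a function with domain `A`. -/
def isFun (f A : ℕ) : Fm :=
  ball f (bex (A + 1) (.ex (isOPair 2 1 0))) ∧ˢ
  ball A (.ex (rel (f + 2) 1 0)) ∧ˢ
  ball A (.all (.all (rel (f + 3) 2 1 →ˢ rel (f + 3) 2 0 →ˢ 1 =ˢ 0)))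

/-! ### The axioms of CZF -/

def extensionality : Fm := .all (.all (.all (0 ∈ˢ 2 ↔ˢ 0 ∈ˢ 1) →ˢ 1 =ˢ 0))

def pairing : Fm := .all (.all (.ex (.all (0 ∈ˢ 1 ↔ˢ 0 =ˢ 3 ∨ˢ 0 =ˢ 2))))

def union : Fm := .all (.ex (.all (0 ∈ˢ 1 ↔ˢ bex 2 (1 ∈ˢ 0))))

def infinity : Fm := .ex (.all (0 ∈ˢ 1 ↔ˢ isEmpty 0 ∨ˢ bex 1 (isSucc 1 0)))

/-- `(∀ a, (∀ x ∈ a, φ(x)) → φ(a)) → ∀ a, φ(a)`. -/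
def setInduction (φ : Fm) : Fm :=
  .all (ball 0 (φ.app₁ 2 0) →ˢ φ.app₁ 1 0) →ˢ .all (φ.app₁ 1 0)

/-- `∀ a, ∃ b, ∀ x, x ∈ b ↔ x ∈ a ∧ φ(x)`. -/
def separation (φ : Fm) : Fm := .all (.ex (.all (0 ∈ˢ 1 ↔ˢ 0 ∈ˢ 2 ∧ˢ φ.app₁ 3 0)))

/-- `∀ a, (∀ x ∈ a, ∃ y, φ(x, y)) →
  ∃ b, (∀ x ∈ a, ∃ y ∈ b, φ(x, y)) ∧ (∀ y ∈ b, ∃ x ∈ a, φ(x, y))`. -/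
def strongCollection (φ : Fm) : Fm :=
  .all (ball 0 (.ex (φ.app₂ 3 1 0)) →ˢ
    .ex (ball 1 (bex 1 (φ.app₂ 4 1 0)) ∧ˢ ball 0 (bex 2 (φ.app₂ 4 0 1))))

/-- `∀ a b, ∃ c, ∀ u, (∀ x ∈ a, ∃ y ∈ b, φ(x, y, u)) →
  ∃ d ∈ c, (∀ x ∈ a, ∃ y ∈ d, φ(x, y, u)) ∧ (∀ y ∈ d, ∃ x ∈ a, φ(x, y, u))`. -/
def subsetCollection (φ : Fm) : Fm :=
  .all (.all (.ex (.all (ball 3 (bex 3 (φ.app₃ 6 1 0 2)) →ˢ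
    bex 1 (ball 4 (bex 1 (φ.app₃ 7 1 0 3)) ∧ˢ ball 0 (bex 5 (φ.app₃ 7 0 1 3)))))))

/-- Aczel's constructive Zermelo-Fraenkel set theory. -/
inductive Axioms : Set Fm
  | extensionality : Axioms extensionality
  | pairing : Axioms pairing
  | union : Axioms union
  | infinity : Axioms infinity
  | setInduction (φ : Fm) : Axioms (setInduction φ)
  | separation (φ : Fm) (hφ : Bounded φ) : Axioms (separation φ)
  | strongCollection (φ : Fm) : Axioms (strongCollection φ)
  | subsetCollection (φ : Fm) : Axioms (subsetCollection φ)

/-! ### The principle NID -/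

/-- The class `M` of sets is set-generated: there is a set `G` of elements of `M` such that for all
`α` in `M` and `a ∈ α` there is `β ∈ G` with `a ∈ β ⊆ α`. -/
def setGenerated (M : Fm) : Fm :=
  .ex (ball 0 (M.app₁ 2 0) ∧ˢ
    .all (M.app₁ 2 0 →ˢ ball 0 (bex 2 (1 ∈ˢ 0 ∧ˢ sub 0 2))))

/-- `R` is a set of rules on `X`, that is, of pairs of subsets of `X`. -/
def isRules (X R : ℕ) : Fm :=
  ball R (.ex (.ex (isOPair 2 1 0 ∧ˢ sub 1 (X + 3) ∧ˢ sub 0 (X + 3))))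

/-- `Y` is an `R`-closed subset of `X`: for all `(a, b) ∈ R` with `a ⊆ Y`, the intersection of `b`
and `Y` is inhabited. -/
def isClosed (Y X R : ℕ) : Fm :=
  sub Y X ∧ˢ
  .all (.all (rel (R + 2) 1 0 →ˢ sub 1 (Y + 2) →ˢ bex 0 (0 ∈ˢ Y + 3)))

/-- For all sets `X` and all sets `R` of rules on `X`, the class of `R`-closed subsets of `X` is
set-generated. -/
def NID : Fm := .all (.all (isRules 1 0 →ˢ setGenerated (isClosed 0 2 1)))

/-! ### Formal spaces

The variable `P` stands for a set, `L` for a set of pairs `(x, y)`, written `x ≤ y`, and the class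
`K` for the covering relation: `K(a, S)` says `S ∈ Cov(a)`. -/

/-- `L` is reflexive and transitive on `P`. -/
def isPreorder (P L : ℕ) : Fm :=
  ball P (rel (L + 1) 0 0) ∧ˢ
  ball P (ball (P + 1) (ball (P + 2)
    (rel (L + 3) 2 1 →ˢ rel (L + 3) 1 0 →ˢ rel (L + 3) 2 0)))

/-- `S` is a sieve on `a`: a downwards closed subset of `{x ∈ P : x ≤ a}`. -/
def isSieve (S a P L : ℕ) : Fm :=
  sub S P ∧ˢ
  ball S (rel (L + 1) 0 (a + 1)) ∧ˢ
  ball S (ball (P + 1) (rel (L + 2) 0 1 →ˢ 0 ∈ˢ S + 2))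

/-- `S' = {x ∈ S : x ≤ b}`. -/
def isRestriction (S' S b L : ℕ) : Fm :=
  .all (0 ∈ˢ S' + 1 ↔ˢ 0 ∈ˢ S + 1 ∧ˢ rel (L + 1) 0 (b + 1))

/-- `(P, ≤, Cov)` is a formal space: `P` is preordered by `≤` and `Cov` assigns to every `a ∈ P` a
class of sieves on `a`, subject to maximality, stability and local character. -/
def isFormalSpace (P L : ℕ) (K : Fm) : Fm :=
  isPreorder P L ∧ˢ
  -- elements of `Cov(a)` are sieves on `a`
  ball P (.all (K.app₂ 2 1 0 →ˢ isSieve 0 1 (P + 2) (L + 2))) ∧ˢ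
  -- the maximal sieve `{x ∈ P : x ≤ a}` is in `Cov(a)`
  ball P (.all (isRestriction 0 (P + 2) 1 (L + 2) →ˢ K.app₂ 2 1 0)) ∧ˢ
  -- if `b ≤ a` and `S ∈ Cov(a)`, then `{x ∈ S : x ≤ b} ∈ Cov(b)`
  ball P (ball (P + 1) (.all (.all (rel (L + 4) 2 3 →ˢ K.app₂ 4 3 1 →ˢ
    isRestriction 0 1 2 (L + 4) →ˢ K.app₂ 4 2 0)))) ∧ˢ
  -- if `S` is a sieve on `a`, `R ∈ Cov(a)`, and `{x ∈ S : x ≤ b} ∈ Cov(b)` for all `b ∈ R`,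
  -- then `S ∈ Cov(a)`
  ball P (.all (.all (isSieve 1 2 (P + 3) (L + 3) →ˢ K.app₂ 3 2 0 →ˢ
    ball 0 (.all (isRestriction 0 3 1 (L + 5) →ˢ K.app₂ 5 1 0)) →ˢ K.app₂ 3 2 1)))

/-- `(P, ≤, Cov)` is set-presented: there is a function `B` that assigns to every `a ∈ P` a set
`B(a)` of subsets of `P`, such that a sieve `S` on `a` is in `Cov(a)` if and only if `R ⊆ S` for
some `R ∈ B(a)`. -/
def isSetPresented (P L : ℕ) (K : Fm) : Fm :=
  .ex (isFun 0 (P + 1) ∧ˢ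
    ball (P + 1) (.all (rel 2 1 0 →ˢ ball 0 (sub 0 (P + 4)))) ∧ˢ
    ball (P + 1) (.all (isSieve 0 1 (P + 3) (L + 3) →ˢ
      (K.app₂ 3 1 0 ↔ˢ .ex (rel 3 2 0 ∧ˢ bex 0 (sub 0 2))))))

/-- `F` is a morphism from the formal space `(P, L, K)` to the formal space `(Q, L', K')`. The
parameters of the classes `K` and `K'` are taken from the variables outside of `d` quantifiers. -/
def isMorphism (d F P L : ℕ) (K : Fm) (Q L' : ℕ) (K' : Fm) : Fm :=
  -- `F ⊆ P × Q`
  ball F (bex (P + 1) (bex (Q + 2) (isOPair 2 1 0))) ∧ˢ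
  -- if `F(p, q)`, `p' ≤ p` and `q ≤ q'`, then `F(p', q')`
  ball P (ball (P + 1) (ball (Q + 2) (ball (Q + 3)
    (rel (F + 4) 3 1 →ˢ rel (L + 4) 2 3 →ˢ rel (L' + 4) 1 0 →ˢ rel (F + 4) 2 0)))) ∧ˢ
  -- if `S ∈ Cov(p)` and `F(p', q)` for all `p' ∈ S`, then `F(p, q)`
  ball Q (ball (P + 1) (.all
    (K.app₂ (d + 3) 1 0 →ˢ ball 0 (rel (F + 4) 0 3) →ˢ rel (F + 3) 1 2))) ∧ˢ
  -- every `p` has a cover `S` such that each `p' ∈ S` is related to some `q' ∈ Q`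
  ball P (.ex (K.app₂ (d + 2) 1 0 ∧ˢ ball 0 (bex (Q + 3) (rel (F + 4) 1 0)))) ∧ˢ
  -- if `F(p, q₀)` and `F(p, q₁)`, then `p` has a cover `S` such that each `p' ∈ S` is related to
  -- some `q' ∈ Q` with `q' ≤ q₀` and `q' ≤ q₁`
  ball Q (ball (Q + 1) (ball (P + 2) (rel (F + 3) 0 2 →ˢ rel (F + 3) 0 1 →ˢ
    .ex (K.app₂ (d + 4) 1 0 ∧ˢ ball 0 (bex (Q + 5)
      (rel (F + 6) 1 0 ∧ˢ rel (L' + 6) 0 5 ∧ˢ rel (L' + 6) 0 4)))))) ∧ˢ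
  -- if `F(p, q)` and `T ∈ Cov'(q)`, then `p` has a cover `S` such that each `p' ∈ S` is related to
  -- some `q' ∈ T`
  ball P (ball (Q + 1) (rel (F + 2) 1 0 →ˢ .all (K'.app₂ (d + 3) 1 0 →ˢ
    .ex (K.app₂ (d + 4) 3 0 ∧ˢ ball 0 (bex 2 (rel (F + 6) 1 0))))))

end CZF

namespace CZF

/-! ### Renaming -/

/-! Conditions (1) and (2) on a morphism F ⊆ P × Q are closure conditions under rules on P × Q.
Conditions (3)–(5) are not: they ask for a cover of p each of whose elements is related to some
element of D (where D is Q, a binary meet {q : q ≤ q₀, q ≤ q₁}, or a cover of q), whereas a rule can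
only ask for one element of a given set. The remedy is to name the inner statement. For a basic
cover R and such a D, a tag (P, (R, D)) is added to the carrier, meaning that every r ∈ R is related
to some q ∈ D. The choice of a cover becomes a rule whose conclusion is the set of tags of (R, D),
with R a basic cover of p (`ruled_hasTag`). The meaning of a tag is imposed by the rules {tag} → {p}
× D, one for each p ∈ R (`ruled_tag`). Set-presentability allows quantifiers over covers to range
over basic covers, so that a set of rules suffices.

The extension of a morphism F by all true tags is closed under these rules. Conversely, if Y is
closed, then Y ∩ (P × Q) is a morphism (`isMorphism_of_closed`); Y may omit true tags, since only
the soundness of those present is needed. NID gives a generating set of closed sets, and their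
restrictions to P × Q generate the morphisms: if z ∈ F has extension Y and z ∈ Y' ⊆ Y with Y' a
generator, then z ∈ Y' ∩ (P × Q) ⊆ Y ∩ (P × Q) = F. The last equation holds because P ∉ P keeps tags
out of P × Q.

The set of rules is never written down explicitly. `ruled` expresses that some set of valid rules
enforces a property, and such properties are closed under conjunction, bounded quantification and
implication from bounded premises (`ruled_and`, `ruled_ball`, `ruled_imp`). `ruled_generates` then
applies NID.

Derivations are handled as Lean functions: contexts grow along `Le`, and object-level quantifiers
are handled by Lean quantification over variables, justified by the choice of a fresh one. -/

theorem liftRen_comp (ρ σ : ℕ → ℕ) : liftRen σ ∘ liftRen ρ = liftRen (σ ∘ ρ) := by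
  funext n; cases n <;> rfl

theorem liftRen_id : liftRen id = id := by
  funext n; cases n <;> rfl

theorem Fm.ren_ren (φ : Fm) (ρ σ : ℕ → ℕ) : (φ.ren ρ).ren σ = φ.ren (σ ∘ ρ) := by
  induction φ generalizing ρ σ <;> simp_all [Fm.ren, liftRen_comp]

theorem Fm.ren_id (φ : Fm) : φ.ren id = φ := by
  induction φ <;> simp_all [Fm.ren, liftRen_id]

theorem Fm.ren_inst (φ : Fm) (t : ℕ) (ρ : ℕ → ℕ) :
    (φ.inst t).ren ρ = (φ.ren (liftRen ρ)).inst (ρ t) := by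
  simp only [Fm.inst, Fm.ren_ren]
  congr 1; funext n; cases n <;> rfl

theorem Fm.ren_shift (φ : Fm) (ρ : ℕ → ℕ) : φ.shift.ren (liftRen ρ) = (φ.ren ρ).shift := by
  simp only [Fm.shift, Fm.ren_ren]; rfl

theorem Fm.inst_shift (φ : Fm) (t : ℕ) : φ.shift.inst t = φ := by
  simp only [Fm.shift, Fm.inst, Fm.ren_ren]; exact φ.ren_id

/-- The free variables of a formula are bounded. -/
theorem Fm.exists_bound (φ : Fm) :
    ∃ N, ∀ ρ σ : ℕ → ℕ, (∀ n < N, ρ n = σ n) → φ.ren ρ = φ.ren σ := by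
  induction φ with
  | mem x y => exact ⟨x + y + 1, fun ρ σ h => by
      simp [Fm.ren, h x (by omega), h y (by omega)]⟩
  | eq x y => exact ⟨x + y + 1, fun ρ σ h => by
      simp [Fm.ren, h x (by omega), h y (by omega)]⟩
  | bot => exact ⟨0, fun _ _ _ => rfl⟩
  | and φ ψ hφ hψ | or φ ψ hφ hψ | imp φ ψ hφ hψ =>
    obtain ⟨M, hM⟩ := hφ
    obtain ⟨N, hN⟩ := hψ
    exact ⟨M + N, fun ρ σ h => by
      simp [Fm.ren, hM ρ σ fun n hn => h n (by omega), hN ρ σ fun n hn => h n (by omega)]⟩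
  | all φ hφ | ex φ hφ =>
    obtain ⟨M, hM⟩ := hφ
    refine ⟨M, fun ρ σ h => ?_⟩
    simp only [Fm.ren]
    rw [hM]
    rintro (_ | n) hn
    · rfl
    · simp [liftRen, h n (by omega)]

theorem exists_bound_list (Γ : List Fm) :
    ∃ N, ∀ φ ∈ Γ, ∀ ρ σ : ℕ → ℕ, (∀ n < N, ρ n = σ n) → φ.ren ρ = φ.ren σ := by
  induction Γ with
  | nil => exact ⟨0, by simp⟩
  | cons φ Γ ih =>
    obtain ⟨M, hM⟩ := φ.exists_bound
    obtain ⟨N, hN⟩ := ih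
    refine ⟨M + N, fun ψ hψ ρ σ h => ?_⟩
    rcases List.mem_cons.1 hψ with rfl | hψ
    · exact hM ρ σ fun n hn => h n (by omega)
    · exact hN ψ hψ ρ σ fun n hn => h n (by omega)

/-! ### Admissible rules -/

theorem Provable.weaken {T : Set Fm} {Γ : List Fm} {φ : Fm} (h : Provable T Γ φ) :
    ∀ {Δ : List Fm}, Γ ⊆ Δ → Provable T Δ φ := by
  induction h with
  | ax h => exact fun _ => .ax h
  | hyp h => exact fun s => .hyp (s h)
  | botE _ ih => exact fun s => .botE (ih s)
  | andI _ _ ih₁ ih₂ => exact fun s => .andI (ih₁ s) (ih₂ s)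
  | andE₁ _ ih => exact fun s => .andE₁ (ih s)
  | andE₂ _ ih => exact fun s => .andE₂ (ih s)
  | orI₁ _ ih => exact fun s => .orI₁ (ih s)
  | orI₂ _ ih => exact fun s => .orI₂ (ih s)
  | orE _ _ _ ih ih₁ ih₂ =>
    exact fun s => .orE (ih s) (ih₁ (List.cons_subset_cons _ s)) (ih₂ (List.cons_subset_cons _ s))
  | impI _ ih => exact fun s => .impI (ih (List.cons_subset_cons _ s))
  | impE _ _ ih₁ ih₂ => exact fun s => .impE (ih₁ s) (ih₂ s)
  | allI _ ih => exact fun s => .allI (ih (List.map_subset _ s))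
  | allE t _ ih => exact fun s => .allE t (ih s)
  | exI t _ ih => exact fun s => .exI t (ih s)
  | exE _ _ ih₁ ih₂ =>
    exact fun s => .exE (ih₁ s) (ih₂ (List.cons_subset_cons _ (List.map_subset _ s)))
  | eqI t => exact fun _ => .eqI t
  | eqE φ _ _ ih₁ ih₂ => exact fun s => .eqE φ (ih₁ s) (ih₂ s)

theorem map_shift_ren (Γ : List Fm) (ρ : ℕ → ℕ) :
    (Γ.map Fm.shift).map (Fm.ren (liftRen ρ)) = (Γ.map (Fm.ren ρ)).map Fm.shift := by
  simp [Fm.ren_shift]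

theorem Provable.ren {T : Set Fm} (hT : ∀ φ ∈ T, ∀ ρ, φ.ren ρ ∈ T) {Γ : List Fm} {φ : Fm}
    (h : Provable T Γ φ) : ∀ ρ, Provable T (Γ.map (Fm.ren ρ)) (φ.ren ρ) := by
  induction h with
  | ax h => exact fun ρ => .ax (hT _ h ρ)
  | hyp h => exact fun ρ => .hyp (List.mem_map_of_mem h)
  | botE _ ih => exact fun ρ => .botE (ih ρ)
  | andI _ _ ih₁ ih₂ => exact fun ρ => .andI (ih₁ ρ) (ih₂ ρ)
  | andE₁ _ ih => exact fun ρ => .andE₁ (ih ρ)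
  | andE₂ _ ih => exact fun ρ => .andE₂ (ih ρ)
  | orI₁ _ ih => exact fun ρ => .orI₁ (ih ρ)
  | orI₂ _ ih => exact fun ρ => .orI₂ (ih ρ)
  | orE _ _ _ ih ih₁ ih₂ => exact fun ρ => .orE (ih ρ) (ih₁ ρ) (ih₂ ρ)
  | impI _ ih => exact fun ρ => .impI (ih ρ)
  | impE _ _ ih₁ ih₂ => exact fun ρ => .impE (ih₁ ρ) (ih₂ ρ)
  | allI _ ih => exact fun ρ => .allI (map_shift_ren _ ρ ▸ ih (liftRen ρ))
  | @allE _ φ t _ ih => exact fun ρ => φ.ren_inst t ρ ▸ .allE (ρ t) (ih ρ)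
  | @exI _ φ t _ ih => exact fun ρ => .exI (ρ t) (φ.ren_inst t ρ ▸ ih ρ)
  | @exE Γ φ ψ _ _ ih₁ ih₂ =>
    intro ρ
    refine .exE (ih₁ ρ) ?_
    have := ih₂ (liftRen ρ)
    rwa [List.map_cons, map_shift_ren, Fm.ren_shift] at this
  | eqI t => exact fun ρ => .eqI (ρ t)
  | @eqE _ s t φ _ _ ih₁ ih₂ =>
    intro ρ
    rw [Fm.ren_inst]
    exact .eqE _ (ih₁ ρ) (φ.ren_inst s ρ ▸ ih₂ ρ)

/-- There is a variable `t` that is fresh for `Γ` and `φ`, with a renaming `ρ` that turns `t` into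
the bound variable. -/
theorem exists_fresh (Γ : List Fm) (φ : Fm) : ∃ (t : ℕ) (ρ : ℕ → ℕ),
    Γ.map (Fm.ren ρ) = Γ.map Fm.shift ∧ (φ.inst t).ren ρ = φ := by
  obtain ⟨M, hM⟩ := exists_bound_list Γ
  obtain ⟨N, hN⟩ := φ.exists_bound
  -- Renaming `Γ` and `φ` depends only on variables below `M + N`, so the exceptional value of the
  -- renaming is met only at the inserted variable.
  refine ⟨M + N, fun n => if n = M + N then 0 else n + 1, ?_, ?_⟩
  · refine List.map_congr_left fun ψ hψ => hM ψ hψ _ _ fun n hn => ?_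
    simp [show n ≠ M + N by omega]
  · rw [Fm.inst, Fm.ren_ren]
    conv_rhs => rw [← φ.ren_id]
    refine hN _ _ fun n hn => ?_
    rcases n with _ | n
    · simp
    · simp [show n ≠ M + N by omega]

/-- Among the given derivations is one for a fresh variable, and renaming that variable to `0`
yields the premise of the quantifier rule. -/
theorem Provable.all_of_forall {T : Set Fm} (hT : ∀ φ ∈ T, ∀ ρ, φ.ren ρ ∈ T) {Γ : List Fm}
    {φ : Fm} (h : ∀ t, Provable T Γ (φ.inst t)) : Provable T Γ (.all φ) := by
  obtain ⟨t, ρ, h₁, h₂⟩ := exists_fresh Γ φ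
  have := (h t).ren hT ρ
  rw [h₁, h₂] at this
  exact .allI this

theorem Provable.ex_elim {T : Set Fm} (hT : ∀ φ ∈ T, ∀ ρ, φ.ren ρ ∈ T) {Γ : List Fm}
    {φ ψ : Fm} (h : Provable T Γ (.ex φ)) (k : ∀ t, Provable T (φ.inst t :: Γ) ψ) :
    Provable T Γ ψ := by
  -- The eigenvariable must also be fresh for the conclusion `ψ`.
  obtain ⟨t, ρ, h₁, h₂⟩ := exists_fresh (ψ :: Γ) φ
  have := (k t).ren hT ρ
  rw [List.map_cons, List.map_cons, List.cons.injEq] at h₁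
  rw [List.map_cons, h₁.2, h₁.1, h₂] at this
  exact .exE h this

/-! ### The axioms are closed under renaming -/

theorem Bounded.ren {φ : Fm} (h : Bounded φ) : ∀ ρ, Bounded (φ.ren ρ) := by
  induction h with
  | mem x y => exact fun ρ => .mem _ _
  | eq x y => exact fun ρ => .eq _ _
  | bot => exact fun _ => .bot
  | and _ _ ih₁ ih₂ => exact fun ρ => .and (ih₁ ρ) (ih₂ ρ)
  | or _ _ ih₁ ih₂ => exact fun ρ => .or (ih₁ ρ) (ih₂ ρ)
  | imp _ _ ih₁ ih₂ => exact fun ρ => .imp (ih₁ ρ) (ih₂ ρ)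
  | ball x _ ih => exact fun ρ => .ball (ρ x) (ih (liftRen ρ))
  | bex x _ ih => exact fun ρ => .bex (ρ x) (ih (liftRen ρ))

theorem Fm.app₁_ren (φ : Fm) {d d' : ℕ} (x : ℕ) {ρ σ : ℕ → ℕ} (h : ∀ n, ρ (n + d) = σ n + d') :
    (φ.app₁ d x).ren ρ = (φ.ren (liftRen σ)).app₁ d' (ρ x) := by
  simp only [Fm.app₁, Fm.ren_ren]
  congr 1; funext n; rcases n with _ | n
  · rfl
  · exact h n

theorem Fm.app₂_ren (φ : Fm) {d d' : ℕ} (x y : ℕ) {ρ σ : ℕ → ℕ}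
    (h : ∀ n, ρ (n + d) = σ n + d') :
    (φ.app₂ d x y).ren ρ = (φ.ren (liftRen (liftRen σ))).app₂ d' (ρ x) (ρ y) := by
  simp only [Fm.app₂, Fm.ren_ren]
  congr 1; funext n; rcases n with _ | _ | n
  · rfl
  · rfl
  · exact h n

theorem Fm.app₃_ren (φ : Fm) {d d' : ℕ} (x y z : ℕ) {ρ σ : ℕ → ℕ}
    (h : ∀ n, ρ (n + d) = σ n + d') :
    (φ.app₃ d x y z).ren ρ =
      (φ.ren (liftRen (liftRen (liftRen σ)))).app₃ d' (ρ x) (ρ y) (ρ z) := by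
  simp only [Fm.app₃, Fm.ren_ren]
  congr 1; funext n; rcases n with _ | _ | _ | n
  · rfl
  · rfl
  · rfl
  · exact h n

/-- The single axioms are sentences. For the schemata, renaming an instance only renames the
parameters of the formula, which gives another instance; separation also needs that boundedness
survives renaming. -/
theorem Axioms.ren (φ : Fm) (h : φ ∈ Axioms) (ρ : ℕ → ℕ) : φ.ren ρ ∈ Axioms := by
  cases h with
  | extensionality => exact .extensionality
  | pairing => exact .pairing
  | union => exact .union
  | infinity => exact .infinity
  | setInduction φ =>
    simp only [CZF.setInduction, Fm.ren, ball,
      φ.app₁_ren (d := 2) (d' := 2) (ρ := liftRen (liftRen ρ)) (σ := ρ) _ fun _ => rfl,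
      φ.app₁_ren (d := 1) (d' := 1) (ρ := liftRen ρ) (σ := ρ) _ fun _ => rfl]
    exact Axioms.setInduction (φ.ren (liftRen ρ))
  | separation φ hφ =>
    simp only [CZF.separation, Fm.ren, Fm.iff,
      φ.app₁_ren (d := 3) (d' := 3) (ρ := liftRen (liftRen (liftRen ρ))) (σ := ρ) _
        fun _ => rfl]
    exact Axioms.separation (φ.ren (liftRen ρ)) (hφ.ren _)
  | strongCollection φ =>
    simp only [CZF.strongCollection, Fm.ren, ball, bex,
      φ.app₂_ren (d := 3) (d' := 3) (ρ := liftRen (liftRen (liftRen ρ))) (σ := ρ) _ _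
        fun _ => rfl,
      φ.app₂_ren (d := 4) (d' := 4) (ρ := liftRen (liftRen (liftRen (liftRen ρ)))) (σ := ρ) _ _
        fun _ => rfl]
    exact Axioms.strongCollection (φ.ren (liftRen (liftRen ρ)))
  | subsetCollection φ =>
    simp only [CZF.subsetCollection, Fm.ren, ball, bex,
      φ.app₃_ren (d := 6) (d' := 6)
        (ρ := liftRen (liftRen (liftRen (liftRen (liftRen (liftRen ρ)))))) (σ := ρ) _ _ _
        fun _ => rfl,
      φ.app₃_ren (d := 7) (d' := 7)
        (ρ := liftRen (liftRen (liftRen (liftRen (liftRen (liftRen (liftRen ρ)))))))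
        (σ := ρ) _ _ _ fun _ => rfl]
    exact Axioms.subsetCollection (φ.ren (liftRen (liftRen (liftRen ρ))))

/-! ### Reasoning in contexts

`Γ ⊩ φ` says that `φ` is derivable in CZF from `Γ`, and `Γ ⊫ φ` that it is derivable from all
contexts that extend `Γ`. The extensions of contexts are found by instance search. -/

/-- `Δ` derives all that `Γ` derives. -/
class Le (Γ : semiOutParam (List Fm)) (Δ : List Fm) : Prop where
  le : ∀ {φ}, Provable Axioms Γ φ → Provable Axioms Δ φ

instance Le.trans {Γ Γ' Δ : List Fm} [h : Le Γ' Δ] [h' : Le Γ Γ'] : Le Γ Δ :=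
  ⟨fun p => h.le (h'.le p)⟩

instance (priority := high) Le.refl (Γ : List Fm) : Le Γ Γ := ⟨id⟩

theorem le_cons (φ : Fm) (Γ : List Fm) : Le Γ (φ :: Γ) :=
  ⟨fun h => h.weaken fun _ => .tail _⟩

local notation:26 Γ:26 " ⊩ " φ:20 => Provable Axioms Γ φ

/-- `φ` is derivable from all extensions of `Γ`. -/
abbrev Stable (Γ : List Fm) (φ : Fm) : Prop := ∀ {Θ : List Fm} [Le Γ Θ], Provable Axioms Θ φ

local notation:26 Γ:26 " ⊫ " φ:20 => Stable Γ φ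

variable {Γ : List Fm}

theorem stable {φ : Fm} (h : Γ ⊩ φ) : Γ ⊫ φ := Le.le h

theorem stable_cons {φ : Fm} {Γ : List Fm} : φ :: Γ ⊫ φ := stable (Γ := φ :: Γ) (.hyp (.head _))

/-- The continuation is used only for the context `φ :: Γ`. Stating it for an arbitrary extension
lets earlier stable hypotheses be reused without explicit weakening. -/
theorem impI {φ ψ : Fm} (k : ∀ Δ [Le Γ Δ], (Δ ⊫ φ) → Δ ⊩ ψ) : Γ ⊩ φ →ˢ ψ :=
  .impI (@k _ (le_cons φ Γ) (stable_cons (Γ := Γ)))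

theorem mp {φ ψ : Fm} (h : Γ ⊩ φ →ˢ ψ) (h' : Γ ⊩ φ) : Γ ⊩ ψ := .impE h h'

theorem both {φ ψ : Fm} (h : Γ ⊩ φ) (h' : Γ ⊩ ψ) : Γ ⊩ φ ∧ˢ ψ := .andI h h'

theorem fst {φ ψ : Fm} (h : Γ ⊩ φ ∧ˢ ψ) : Γ ⊩ φ := .andE₁ h

theorem snd {φ ψ : Fm} (h : Γ ⊩ φ ∧ˢ ψ) : Γ ⊩ ψ := .andE₂ h

theorem orE {φ ψ χ : Fm} (h : Γ ⊩ φ ∨ˢ ψ) (k₁ : ∀ Δ [Le Γ Δ], (Δ ⊫ φ) → Δ ⊩ χ)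
    (k₂ : ∀ Δ [Le Γ Δ], (Δ ⊫ ψ) → Δ ⊩ χ) : Γ ⊩ χ :=
  .orE h (@k₁ _ (le_cons φ Γ) (stable_cons (Γ := Γ))) (@k₂ _ (le_cons ψ Γ) (stable_cons (Γ := Γ)))

theorem allI {φ : Fm} (k : ∀ x, Γ ⊩ φ.inst x) : Γ ⊩ .all φ :=
  Provable.all_of_forall Axioms.ren k

theorem allE {φ : Fm} (h : Γ ⊩ .all φ) (x : ℕ) : Γ ⊩ φ.inst x := .allE x h

theorem exI {φ : Fm} (x : ℕ) (h : Γ ⊩ φ.inst x) : Γ ⊩ .ex φ := .exI x h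

theorem exE {φ χ : Fm} (h : Γ ⊩ .ex φ) (k : ∀ Δ [Le Γ Δ] x, (Δ ⊫ φ.inst x) → Δ ⊩ χ) :
    Γ ⊩ χ :=
  Provable.ex_elim Axioms.ren h fun x => @k _ (le_cons _ Γ) x (stable_cons (Γ := Γ))

theorem ballI {a : ℕ} {φ : Fm} (k : ∀ Δ [Le Γ Δ] x, (Δ ⊫ x ∈ˢ a) → Δ ⊩ φ.inst x) :
    Γ ⊩ ball a φ :=
  allI fun x => impI fun Δ _ hx => k Δ x hx

theorem ballE {a x : ℕ} {φ : Fm} (h : Γ ⊩ ball a φ) (hx : Γ ⊩ x ∈ˢ a) : Γ ⊩ φ.inst x :=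
  mp (allE h x) hx

theorem bexI {a : ℕ} {φ : Fm} (x : ℕ) (hx : Γ ⊩ x ∈ˢ a) (h : Γ ⊩ φ.inst x) : Γ ⊩ bex a φ :=
  exI x (both hx h)

theorem bexE {a : ℕ} {φ χ : Fm} (h : Γ ⊩ bex a φ)
    (k : ∀ Δ [Le Γ Δ] x, (Δ ⊫ x ∈ˢ a) → (Δ ⊫ φ.inst x) → Δ ⊩ χ) : Γ ⊩ χ :=
  exE h fun Δ _ x hx => k Δ x (fst hx) (snd hx)

theorem subI {a b : ℕ} (k : ∀ Δ [Le Γ Δ] x, (Δ ⊫ x ∈ˢ a) → Δ ⊩ x ∈ˢ b) : Γ ⊩ sub a b :=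
  ballI k

theorem subE {a b x : ℕ} (h : Γ ⊩ sub a b) (hx : Γ ⊩ x ∈ˢ a) : Γ ⊩ x ∈ˢ b := ballE h hx

/-! ### Equality and extensionality -/

theorem refl (a : ℕ) : Γ ⊩ a =ˢ a := .eqI a

theorem subst (φ : Fm) {a b : ℕ} (h : Γ ⊩ a =ˢ b) (h' : Γ ⊩ φ.inst a) : Γ ⊩ φ.inst b :=
  .eqE φ h h'

theorem symm {a b : ℕ} (h : Γ ⊩ a =ˢ b) : Γ ⊩ b =ˢ a := subst (0 =ˢ a + 1) h (refl a)

theorem trans {a b c : ℕ} (h : Γ ⊩ a =ˢ b) (h' : Γ ⊩ b =ˢ c) : Γ ⊩ a =ˢ c :=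
  subst (a + 1 =ˢ 0) h' h

theorem mem_of_eq {a b c : ℕ} (h : Γ ⊩ a =ˢ b) (h' : Γ ⊩ a ∈ˢ c) : Γ ⊩ b ∈ˢ c :=
  subst (0 ∈ˢ c + 1) h h'

theorem mem_of_mem_eq {a b c : ℕ} (h : Γ ⊩ b =ˢ c) (h' : Γ ⊩ a ∈ˢ b) : Γ ⊩ a ∈ˢ c :=
  subst (a + 1 ∈ˢ 0) h h'

theorem ext {a b : ℕ} (h : ∀ Δ [Le Γ Δ] x, (Δ ⊫ x ∈ˢ a) → Δ ⊩ x ∈ˢ b)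
    (h' : ∀ Δ [Le Γ Δ] x, (Δ ⊫ x ∈ˢ b) → Δ ⊩ x ∈ˢ a) : Γ ⊩ a =ˢ b := by
  have h₀ : Γ ⊩ extensionality := .ax .extensionality
  have h₁ : Γ ⊩ .all (.all (0 ∈ˢ a + 2 ↔ˢ 0 ∈ˢ 1) →ˢ a + 1 =ˢ 0) := allE h₀ a
  have h₂ : Γ ⊩ .all (0 ∈ˢ a + 1 ↔ˢ 0 ∈ˢ b + 1) →ˢ a =ˢ b := allE h₁ b
  exact mp h₂ (allI fun x => both (impI fun Δ _ hx => h Δ x hx) (impI fun Δ _ hx => h' Δ x hx))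

/-! ### Set existence -/

/-- The language has no terms for sets, so set existence takes the form of an elimination: an
arbitrary goal may be derived with a variable denoting the new set. -/
theorem upairE (a b : ℕ) {χ : Fm} (k : ∀ Δ [Le Γ Δ] z, (Δ ⊫ isUPair z a b) → Δ ⊩ χ) :
    Γ ⊩ χ := by
  have h₀ : Γ ⊩ pairing := .ax .pairing
  have h₁ : Γ ⊩ .all (.ex (.all (0 ∈ˢ 1 ↔ˢ 0 =ˢ a + 3 ∨ˢ 0 =ˢ 2))) := allE h₀ a
  have h₂ : Γ ⊩ .ex (.all (0 ∈ˢ 1 ↔ˢ 0 =ˢ a + 2 ∨ˢ 0 =ˢ b + 2)) := allE h₁ b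
  refine exE h₂ fun Δ _ z (hz : Δ ⊫ .all (0 ∈ˢ z + 1 ↔ˢ 0 =ˢ a + 1 ∨ˢ 0 =ˢ b + 1)) =>
    k Δ z (both ?_ (both ?_ (ballI ?_)))
  · exact mp (snd (allE hz a)) (.orI₁ (refl a))
  · exact mp (snd (allE hz b)) (.orI₂ (refl b))
  · exact fun Θ _ x hx => mp (fst (allE hz x)) hx

theorem upairCases {z a b x : ℕ} (h : Γ ⊩ isUPair z a b) (hx : Γ ⊩ x ∈ˢ z) :
    Γ ⊩ x =ˢ a ∨ˢ x =ˢ b := ballE (snd (snd h)) hx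

theorem singletonE {z a x : ℕ} (h : Γ ⊩ isUPair z a a) (hx : Γ ⊩ x ∈ˢ z) : Γ ⊩ x =ˢ a :=
  orE (upairCases h hx) (fun _ _ h => h) (fun _ _ h => h)

/-- Elimination of the union `b` of the set `a`. -/
theorem unionE (a : ℕ) {χ : Fm}
    (k : ∀ Δ [Le Γ Δ] b,
      (∀ {Θ : List Fm} [Le Δ Θ] {x y : ℕ}, (Θ ⊩ x ∈ˢ y) → (Θ ⊩ y ∈ˢ a) → (Θ ⊩ x ∈ˢ b)) →
      (∀ {Θ : List Fm} [Le Δ Θ] {x : ℕ}, (Θ ⊩ x ∈ˢ b) → (Θ ⊩ bex a (x + 1 ∈ˢ 0))) →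
      Δ ⊩ χ) : Γ ⊩ χ := by
  have h₀ : Γ ⊩ union := .ax .union
  have h₁ : Γ ⊩ .ex (.all (0 ∈ˢ 1 ↔ˢ bex (a + 2) (1 ∈ˢ 0))) := allE h₀ a
  refine exE h₁ fun Δ _ b (hb : Δ ⊫ .all (0 ∈ˢ b + 1 ↔ˢ bex (a + 1) (1 ∈ˢ 0))) => k Δ b ?_ ?_
  · exact fun {Θ} _ {x y} hx hy => mp (snd (allE hb x)) (bexI y hy hx)
  · exact fun {Θ} _ {x} hx => mp (fst (allE hb x)) hx

/-- The renaming that instantiates the variable `0` by `t`. -/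
def instRen (t : ℕ) : ℕ → ℕ
  | 0 => t
  | n + 1 => n

theorem Fm.inst_eq (φ : Fm) (t : ℕ) : φ.inst t = φ.ren (instRen t) := by
  rw [Fm.inst]; rfl

theorem sepE (φ : Fm) (hφ : Bounded φ) (a : ℕ) {χ : Fm}
    (k : ∀ Δ [Le Γ Δ] b,
      (∀ {Θ : List Fm} [Le Δ Θ] {x : ℕ}, (Θ ⊩ x ∈ˢ a) → (Θ ⊩ φ.inst x) → (Θ ⊩ x ∈ˢ b)) →
      (∀ {Θ : List Fm} [Le Δ Θ] {x : ℕ}, (Θ ⊩ x ∈ˢ b) → (Θ ⊩ x ∈ˢ a)) →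
      (∀ {Θ : List Fm} [Le Δ Θ] {x : ℕ}, (Θ ⊩ x ∈ˢ b) → (Θ ⊩ φ.inst x)) →
      Δ ⊩ χ) : Γ ⊩ χ := by
  have h₀ : Γ ⊩ separation φ := .ax (.separation φ hφ)
  have h₁ := allE h₀ a
  refine exE h₁ fun Δ _ b hb => ?_
  have e : ∀ x, ((((φ.app₁ 3 0).ren (liftRen (liftRen (instRen a)))).ren
      (liftRen (instRen b))).inst x) = φ.inst x := fun x => by
    simp only [Fm.app₁, Fm.inst, Fm.ren_ren]
    congr 1; funext n; rcases n with _ | n <;> rfl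
  have hb' : ∀ {Θ : List Fm} [Le Δ Θ] (x : ℕ),
      (Θ ⊩ x ∈ˢ b ↔ˢ x ∈ˢ a ∧ˢ φ.inst x) := fun {Θ} _ x => by
    have := allE hb x (Γ := Θ)
    rw [← e]
    exact this
  exact k Δ b (fun {Θ} _ {x} h₁ h₂ => mp (snd (hb' x)) (both h₁ h₂))
    (fun {Θ} _ {x} h => fst (mp (fst (hb' x)) h)) (fun {Θ} _ {x} h => snd (mp (fst (hb' x)) h))

theorem collE (φ : Fm) (a : ℕ) {χ : Fm}
    (h : ∀ Δ [Le Γ Δ] x, (Δ ⊫ x ∈ˢ a) → Δ ⊩ .ex (φ.app₂ 1 (x + 1) 0))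
    (k : ∀ Δ [Le Γ Δ] b,
      (∀ {Θ : List Fm} [Le Δ Θ] {x : ℕ}, (Θ ⊩ x ∈ˢ a) → Θ ⊩ bex b (φ.app₂ 1 (x + 1) 0)) →
      (∀ {Θ : List Fm} [Le Δ Θ] {y : ℕ}, (Θ ⊩ y ∈ˢ b) → Θ ⊩ bex a (φ.app₂ 1 0 (y + 1))) →
      Δ ⊩ χ) : Γ ⊩ χ := by
  have h₀ : Γ ⊩ strongCollection φ := .ax (.strongCollection φ)
  have h₁ : Γ ⊩ ball a (.ex (φ.app₂ 2 1 0)) →ˢ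
      .ex (ball (a + 1) (bex 1 (φ.app₂ 3 1 0)) ∧ˢ ball 0 (bex (a + 2) (φ.app₂ 3 0 1))) := by
    have := allE h₀ a
    have e₁ : (φ.app₂ 3 1 0).ren (liftRen (liftRen (instRen a))) = φ.app₂ 2 1 0 := by
      simp only [Fm.app₂, Fm.ren_ren]
      congr 1; funext n; rcases n with _ | _ | n <;> rfl
    have e₂ : (φ.app₂ 4 1 0).ren (liftRen (liftRen (liftRen (instRen a)))) =
        φ.app₂ 3 1 0 := by
      simp only [Fm.app₂, Fm.ren_ren]
      congr 1; funext n; rcases n with _ | _ | n <;> rfl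
    have e₃ : (φ.app₂ 4 0 1).ren (liftRen (liftRen (liftRen (instRen a)))) =
        φ.app₂ 3 0 1 := by
      simp only [Fm.app₂, Fm.ren_ren]
      congr 1; funext n; rcases n with _ | _ | n <;> rfl
    simp only [Fm.inst_eq, Fm.ren, ball, bex, e₁, e₂, e₃] at this
    exact this
  refine exE (mp h₁ (ballI fun Δ _ x hx => ?_)) fun Δ _ b hb => k Δ b ?_ ?_
  · have e : (φ.app₂ 2 1 0).ren (liftRen (instRen x)) = φ.app₂ 1 (x + 1) 0 := by
      simp only [Fm.app₂, Fm.ren_ren]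
      congr 1; funext n; rcases n with _ | _ | n <;> rfl
    have := h Δ x hx
    rw [← e] at this
    exact this
  · intro Θ _ x hx
    have := ballE (fst hb) hx
    have e : (((φ.app₂ 3 1 0).ren (liftRen (liftRen (instRen b)))).ren
        (liftRen (instRen x))) = φ.app₂ 1 (x + 1) 0 := by
      simp only [Fm.app₂, Fm.ren_ren]
      congr 1; funext n; rcases n with _ | _ | n <;> rfl
    rw [← e]
    exact this
  · intro Θ _ y hy
    have := ballE (snd hb) hy
    have e : (((φ.app₂ 3 0 1).ren (liftRen (liftRen (instRen b)))).ren
        (liftRen (instRen y))) = φ.app₂ 1 0 (y + 1) := by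
      simp only [Fm.app₂, Fm.ren_ren]
      congr 1; funext n; rcases n with _ | _ | n <;> rfl
    rw [← e]
    exact this

/-- Set induction for the formula x ∉ x. This is what separates tags from elements of P × Q. -/
theorem not_mem_self (a : ℕ) (h : Γ ⊩ a ∈ˢ a) {χ : Fm} : Γ ⊩ χ := by
  have h₀ : Γ ⊩ .all (ball 0 (0 ∈ˢ 0 →ˢ .bot) →ˢ 0 ∈ˢ 0 →ˢ .bot) →ˢ .all (0 ∈ˢ 0 →ˢ .bot) :=
    .ax (.setInduction (0 ∈ˢ 0 →ˢ .bot))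
  refine .botE (mp (allE (mp h₀ (allI fun x => ?_)) a) h)
  refine impI fun Δ _ (hx : Δ ⊫ ball x (0 ∈ˢ 0 →ˢ .bot)) => impI fun Θ _ (h : Θ ⊫ x ∈ˢ x) => ?_
  exact mp (ballE hx h) h

/-! ### Boundedness -/

theorem bounded_isUPair (z a b : ℕ) : Bounded (isUPair z a b) :=
  .and (.mem _ _) (.and (.mem _ _) (.ball _ (.or (.eq _ _) (.eq _ _))))

theorem bounded_isOPair (z a b : ℕ) : Bounded (isOPair z a b) :=
  .bex _ (.bex _ (.and (bounded_isUPair _ _ _)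
    (.and (bounded_isUPair _ _ _) (bounded_isUPair _ _ _))))

theorem bounded_rel (r a b : ℕ) : Bounded (rel r a b) := .bex _ (bounded_isOPair _ _ _)

/-! ### Ordered pairs -/

theorem upair_unique {z z' a b : ℕ} (h : Γ ⊫ isUPair z a b) (h' : Γ ⊫ isUPair z' a b) :
    Γ ⊩ z =ˢ z' := by
  refine ext (fun Δ _ x hx => ?_) (fun Δ _ x hx => ?_)
  · exact orE (upairCases h hx) (fun _ _ e => mem_of_eq (symm e) (fst h'))
      (fun _ _ e => mem_of_eq (symm e) (fst (snd h')))
  · exact orE (upairCases h' hx) (fun _ _ e => mem_of_eq (symm e) (fst h))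
      (fun _ _ e => mem_of_eq (symm e) (fst (snd h)))

theorem isOPairE {z a b : ℕ} {χ : Fm} (h : Γ ⊩ isOPair z a b)
    (k : ∀ Δ [Le Γ Δ] s t, (Δ ⊫ isUPair s a a) → (Δ ⊫ isUPair t a b) → (Δ ⊫ isUPair z s t) →
      Δ ⊩ χ) : Γ ⊩ χ := by
  refine bexE (Γ := Γ) h fun Δ _ s hs hs' => ?_
  refine bexE (Γ := Δ) hs' fun Θ _ t ht
    (h : Θ ⊫ isUPair s a a ∧ˢ isUPair t a b ∧ˢ isUPair z s t) => ?_
  exact k Θ s t (fst h) (fst (snd h)) (snd (snd h))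

theorem isOPairI {z s t a b : ℕ} (hs : Γ ⊫ isUPair s a a) (ht : Γ ⊫ isUPair t a b)
    (hz : Γ ⊫ isUPair z s t) : Γ ⊩ isOPair z a b :=
  bexI s (fst hz) (bexI t (fst (snd hz)) (both hs (both ht hz)))

theorem opairE (a b : ℕ) {χ : Fm} (k : ∀ Δ [Le Γ Δ] z, (Δ ⊫ isOPair z a b) → Δ ⊩ χ) :
    Γ ⊩ χ := by
  refine upairE a a fun Δ₁ _ s hs => upairE a b fun Δ₂ _ t ht => upairE s t fun Δ _ z hz => ?_
  exact k Δ z (isOPairI hs ht hz)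

theorem opair_unique {z z' a b : ℕ} (h : Γ ⊫ isOPair z a b) (h' : Γ ⊫ isOPair z' a b) :
    Γ ⊩ z =ˢ z' := by
  refine isOPairE h fun Δ _ s t hs ht hz => isOPairE h' fun Δ' _ s' t' hs' ht' hz' => ?_
  have e₁ : Δ' ⊫ s' =ˢ s := upair_unique hs' hs
  have e₂ : Δ' ⊫ t' =ˢ t := upair_unique ht' ht
  have h₁ : Δ' ⊫ isUPair z' s t' := subst (isUPair (z' + 1) 0 (t' + 1)) e₁ hz'
  have h₂ : Δ' ⊫ isUPair z' s t := subst (isUPair (z' + 1) (s + 1) 0) e₂ h₁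
  exact upair_unique hz h₂

/-- The singleton {a} is one of the two elements of z in its second decomposition, and both of these
contain a'. -/
theorem opair_fst {z a b a' b' : ℕ} (h : Γ ⊫ isOPair z a b) (h' : Γ ⊫ isOPair z a' b') :
    Γ ⊩ a =ˢ a' := by
  refine isOPairE h fun Δ _ s t hs ht hz => isOPairE h' fun Δ' _ s' t' hs' ht' hz' => ?_
  refine symm (singletonE hs (orE (upairCases hz' (fst hz)) (fun _ _ e => ?_) (fun _ _ e => ?_)))
  · exact mem_of_mem_eq (symm e) (fst hs')
  · exact mem_of_mem_eq (symm e) (fst ht')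

theorem opair_snd_cases {z a b a' b' : ℕ} (h : Γ ⊫ isOPair z a b) (h' : Γ ⊫ isOPair z a' b') :
    Γ ⊩ b =ˢ b' ∨ˢ b =ˢ a' := by
  refine isOPairE h fun Δ _ s t hs ht hz => isOPairE h' fun Δ' _ s' t' hs' ht' hz' => ?_
  refine orE (upairCases hz' (fst (snd hz))) (fun _ _ e => ?_) (fun _ _ e => ?_)
  · exact .orI₂ (singletonE hs' (mem_of_mem_eq e (fst (snd ht))))
  · exact orE (upairCases ht' (mem_of_mem_eq e (fst (snd ht)))) (fun _ _ e => .orI₂ e)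
      (fun _ _ e => .orI₁ e)

theorem opair_snd {z a b a' b' : ℕ} (h : Γ ⊫ isOPair z a b) (h' : Γ ⊫ isOPair z a' b') :
    Γ ⊩ b =ˢ b' := by
  -- Using the case distinction in both directions avoids deciding whether a = b; the remaining case
  -- b = a', b' = a is closed by a = a'.
  refine orE (opair_snd_cases h h') (fun _ _ e => e) (fun Δ _ e => ?_)
  refine orE (opair_snd_cases h' h) (fun _ _ e => symm e) (fun Δ' _ e' => ?_)
  exact trans e (trans (symm (opair_fst h h')) (symm e'))

/-! ### Relations -/

theorem relI {r z a b : ℕ} (hz : Γ ⊩ z ∈ˢ r) (h : Γ ⊩ isOPair z a b) : Γ ⊩ rel r a b :=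
  bexI z hz h

theorem relE {r a b : ℕ} {χ : Fm} (h : Γ ⊩ rel r a b)
    (k : ∀ Δ [Le Γ Δ] z, (Δ ⊫ z ∈ˢ r) → (Δ ⊫ isOPair z a b) → Δ ⊩ χ) : Γ ⊩ χ :=
  bexE h k

theorem mem_of_rel {r z a b : ℕ} (h : Γ ⊫ rel r a b) (hz : Γ ⊫ isOPair z a b) : Γ ⊩ z ∈ˢ r :=
  relE h fun _ _ _ hz' h' => mem_of_eq (opair_unique h' hz) hz'

theorem rel_sub {r r' a b : ℕ} (h : Γ ⊫ rel r a b) (hr : Γ ⊫ sub r r') : Γ ⊩ rel r' a b :=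
  relE h fun _ _ _ hz h => relI (subE hr hz) h

/-! ### Further set existence -/

theorem cupE (a b : ℕ) {χ : Fm} (k : ∀ Δ [Le Γ Δ] c, (Δ ⊫ sub a c) → (Δ ⊫ sub b c) →
    (∀ {Θ : List Fm} [Le Δ Θ] {x : ℕ}, (Θ ⊩ x ∈ˢ c) → (Θ ⊩ x ∈ˢ a ∨ˢ x ∈ˢ b)) → Δ ⊩ χ) :
    Γ ⊩ χ := by
  refine upairE a b fun Δ' _ z hz => unionE z fun Δ _ c hc hc' => ?_
  refine k Δ c (subI fun _ _ x hx => hc hx (fst hz)) (subI fun _ _ x hx => hc hx (fst (snd hz)))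
    fun {Θ} _ {x} hx => bexE (hc' hx) fun Ξ _ y hy (hxy : Ξ ⊫ x ∈ˢ y) => ?_
  exact orE (upairCases hz hy) (fun _ _ e => .orI₁ (mem_of_mem_eq e hxy))
    (fun _ _ e => .orI₂ (mem_of_mem_eq e hxy))

/-- There is a set that contains all pairs `(x, y)` with `x ∈ a` and `y ∈ b`. -/
theorem prodE (a b : ℕ) {χ : Fm} (k : ∀ Δ [Le Γ Δ] c,
    (∀ {Θ : List Fm} [Le Δ Θ] {x y z : ℕ}, (Θ ⊫ x ∈ˢ a) → (Θ ⊫ y ∈ˢ b) → (Θ ⊫ isOPair z x y) →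
      Θ ⊩ z ∈ˢ c) → Δ ⊩ χ) : Γ ⊩ χ := by
  -- Strong collection is used for y ∈ b with x fixed, and then for x ∈ a; the union of the
  -- resulting sets contains all pairs.
  refine collE (ball (b + 2) (bex 2 (isOPair 0 2 1))) a (fun Δ _ x hx => ?_)
    fun Δ _ d hd _ => unionE d fun Δ' _ c hc _ => ?_
  · refine collE (isOPair 1 (x + 2) 0) b (fun Δ' _ y hy => ?_) fun Δ' _ d hd _ => ?_
    · exact opairE x y fun Θ _ z hz => exI z hz
    · refine exI d (ballI fun Θ _ y hy => bexE (hd hy) fun Ξ _ z hz h => ?_)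
      exact bexI z hz h
  · have : Le Γ Δ' := ⟨fun h => Le.le h⟩
    refine k Δ' c fun {Θ} _ {x y z} hx hy hz => ?_
    refine bexE (hd hx) fun Θ' _ e he (h : Θ' ⊫ ball b (bex (e + 1) (isOPair 0 (x + 2) 1))) => ?_
    refine bexE (ballE h hy) fun Ξ _ z' hz' (h' : Ξ ⊫ isOPair z' x y) => ?_
    exact hc (mem_of_eq (opair_unique h' hz) hz') he

/-! ### Classes that are defined by sets of rules -/

theorem isClosedI {Y X R : ℕ} (h : Γ ⊩ sub Y X)
    (k : ∀ Δ [Le Γ Δ] a b, (Δ ⊫ rel R a b) → (Δ ⊫ sub a Y) → Δ ⊩ bex b (0 ∈ˢ Y + 1)) :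
    Γ ⊩ isClosed Y X R :=
  both h (allI fun a => allI fun b => impI fun _ _ h₁ => impI fun Θ _ h₂ => k Θ a b h₁ h₂)

theorem isClosedE {Y X R a b : ℕ} (h : Γ ⊩ isClosed Y X R) (h₁ : Γ ⊩ rel R a b)
    (h₂ : Γ ⊩ sub a Y) : Γ ⊩ bex b (0 ∈ˢ Y + 1) := by
  have h₃ : Γ ⊩ .all (rel (R + 1) (a + 1) 0 →ˢ sub (a + 1) (Y + 1) →ˢ bex 0 (0 ∈ˢ Y + 2)) :=
    allE (snd h) a
  exact mp (mp (allE h₃ b) h₁) h₂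

/-- There is a set of rules on `X` that belong to the class `V` such that all subsets of `X` that
are closed under these rules belong to the class `H`. -/
def ruled (X : ℕ) (V H : Fm) : Fm :=
  .ex (ball 0 (V.app₁ 2 0) ∧ˢ .all (isClosed 0 (X + 2) 1 →ˢ H.app₁ 2 0))

theorem ruledI {X : ℕ} {V H : Fm} (R : ℕ)
    (hV : ∀ Δ [Le Γ Δ] r, (Δ ⊫ r ∈ˢ R) → Δ ⊩ V.inst r)
    (hH : ∀ Δ [Le Γ Δ] Y, (Δ ⊫ isClosed Y X R) → Δ ⊩ H.inst Y) : Γ ⊩ ruled X V H := by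
  refine exI R (both (ballI fun Δ _ r hr => ?_) (allI fun Y => impI fun Δ _ hY => ?_))
  · have := hV Δ r hr
    have e : ((V.app₁ 2 0).ren (liftRen (instRen R))).inst r = V.inst r := by
      simp only [Fm.app₁, Fm.inst, Fm.ren_ren]
      congr 1; funext n; rcases n with _ | n <;> rfl
    rw [← e] at this
    exact this
  · have := hH Δ Y hY
    have e : ((H.app₁ 2 0).ren (liftRen (instRen R))).inst Y = H.inst Y := by
      simp only [Fm.app₁, Fm.inst, Fm.ren_ren]
      congr 1; funext n; rcases n with _ | n <;> rfl
    rw [← e] at this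
    exact this

theorem ruledE {X : ℕ} {V H χ : Fm} (h : Γ ⊩ ruled X V H)
    (k : ∀ Δ [Le Γ Δ] R,
      (∀ {Θ : List Fm} [Le Δ Θ] {r : ℕ}, (Θ ⊩ r ∈ˢ R) → Θ ⊩ V.inst r) →
      (∀ {Θ : List Fm} [Le Δ Θ] {Y : ℕ}, (Θ ⊩ isClosed Y X R) → Θ ⊩ H.inst Y) → Δ ⊩ χ) :
    Γ ⊩ χ := by
  refine exE h fun Δ _ R hR => k Δ R (fun {Θ} _ {r} hr => ?_) (fun {Θ} _ {Y} hY => ?_)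
  · have := ballE (fst hR) hr
    have e : ((V.app₁ 2 0).ren (liftRen (instRen R))).inst r = V.inst r := by
      simp only [Fm.app₁, Fm.inst, Fm.ren_ren]
      congr 1; funext n; rcases n with _ | n <;> rfl
    rw [← e]
    exact this
  · have := allE (snd (Γ := Θ) hR) Y
    have e : ((H.app₁ 2 0).ren (liftRen (instRen R))).inst Y = H.inst Y := by
      simp only [Fm.app₁, Fm.inst, Fm.ren_ren]
      congr 1; funext n; rcases n with _ | n <;> rfl
    rw [← e]
    exact mp this hY

theorem ruled_mono {X : ℕ} {V H H' : Fm} (h : Γ ⊩ ruled X V H)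
    (k : ∀ Δ [Le Γ Δ] Y, (Δ ⊫ sub Y X) → (Δ ⊫ H.inst Y) → Δ ⊩ H'.inst Y) :
    Γ ⊩ ruled X V H' :=
  ruledE h fun _ _ R hV hH => ruledI R (fun _ _ _ hr => hV hr)
    fun Δ _ Y hY => k Δ Y (fst hY) (hH hY)

theorem isClosed_of_sub {Y X R R' : ℕ} (h : Γ ⊫ isClosed Y X R') (hR : Γ ⊫ sub R R') :
    Γ ⊩ isClosed Y X R :=
  isClosedI (fst h) fun _ _ _ _ h₁ h₂ => isClosedE h (rel_sub h₁ hR) h₂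

/-- Take the union of the two sets of rules: closure under it implies closure under each part. -/
theorem ruled_and {X : ℕ} {V H H' : Fm} (h : Γ ⊫ ruled X V H) (h' : Γ ⊫ ruled X V H') :
    Γ ⊩ ruled X V (H ∧ˢ H') := by
  refine ruledE h fun _ _ R hV hH => ruledE h' fun _ _ R' hV' hH' => ?_
  refine cupE R R' fun _ _ S hS hS' hc => ruledI S (fun _ _ r hr => ?_) fun _ _ Y hY => ?_
  · exact orE (hc hr) (fun _ _ h => hV h) (fun _ _ h => hV' h)
  · exact both (hH (isClosed_of_sub hY hS)) (hH' (isClosed_of_sub hY hS'))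

/-- No set of rules is singled out for an index, so strong collection gathers suitable ones and
their union is taken. The second half of strong collection ensures that each collected set belongs
to some index, so that its rules lie in `V`. -/
theorem ruled_ball {X A : ℕ} {V H : Fm}
    (k : ∀ Δ [Le Γ Δ] i, (Δ ⊫ i ∈ˢ A) → Δ ⊩ ruled X V (H.app₂ 1 (i + 1) 0)) :
    Γ ⊩ ruled X V (ball (A + 1) H) := by
  let φ : Fm := ball 1 (V.app₁ 3 0) ∧ˢ .all (isClosed 0 (X + 3) 2 →ˢ H.app₂ 3 1 0)
  have e₁ : ∀ i, .ex (φ.app₂ 1 (i + 1) 0) = ruled X V (H.app₂ 1 (i + 1) 0) := fun i => by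
    have e₂ : (V.app₁ 3 0).ren (liftRen fun | 0 => i + 1 | 1 => 0 | n + 2 => n + 1) =
        V.app₁ 2 0 := by
      simp only [Fm.app₁, Fm.ren_ren]
      congr 1; funext n; rcases n with _ | n <;> rfl
    have e₃ : (H.app₂ 3 1 0).ren (liftRen fun | 0 => i + 1 | 1 => 0 | n + 2 => n + 1) =
        (H.app₂ 1 (i + 1) 0).app₁ 2 0 := by
      simp only [Fm.app₁, Fm.app₂, Fm.ren_ren]
      congr 1; funext n; rcases n with _ | _ | n <;> rfl
    rw [ruled, ← e₂, ← e₃]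
    rfl
  refine collE φ A (fun Δ _ i hi => e₁ i ▸ k Δ i hi) fun _ _ B hB hB' => ?_
  refine unionE B fun _ _ R hR hR' => ruledI R (fun _ _ r hr => ?_) fun _ _ Y hY => ?_
  · refine bexE (hR' hr) fun _ _ S hS (hrS : _ ⊫ r ∈ˢ S) => bexE (hB' hS) fun Θ _ i hi h => ?_
    have h' : Θ ⊩ (((V.app₁ 3 0).ren (liftRen fun | 0 => 0 | 1 => S + 1 | n + 2 => n + 1)).ren
      (liftRen (instRen i))).inst r := ballE (fst h) hrS
    have e : (((V.app₁ 3 0).ren (liftRen fun | 0 => 0 | 1 => S + 1 | n + 2 => n + 1)).ren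
      (liftRen (instRen i))).inst r = V.inst r := by
      simp only [Fm.app₁, Fm.inst, Fm.ren_ren]
      congr 1; funext n; rcases n with _ | n <;> rfl
    rwa [e] at h'
  · refine ballI fun _ _ i hi => bexE (hB hi) fun Θ _ S hS h => ?_
    have h' : Θ ⊩ isClosed Y X S →ˢ _ := allE (snd h) Y
    have h₂ := mp h' (isClosed_of_sub hY (subI fun _ _ r hr => hR hr hS))
    simp only [Fm.app₂, Fm.ren_ren, Fm.inst] at h₂ ⊢
    convert h₂ using 2
    funext n; rcases n with _ | _ | n <;> rfl

/-- The subset {x ∈ {X} : ψ} exists by bounded separation and is inhabited exactly if ψ holds. The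
implication is therefore a quantification over this set, and ψ need not be decided. -/
theorem ruled_imp {X : ℕ} {V H ψ : Fm} (hψ : Bounded ψ)
    (k : ∀ Δ [Le Γ Δ], (Δ ⊫ ψ) → Δ ⊩ ruled X V H) : Γ ⊩ ruled X V (ψ.shift →ˢ H) := by
  refine upairE X X fun _ _ A hA => sepE ψ.shift (hψ.ren _) A fun Ω _ B hB hB' hB'' => ?_
  have h : Ω ⊫ (ruled X V (ball (B + 1) H.shift)) := ruled_ball fun Δ _ i hi => by
    have e : H.shift.app₂ 1 (i + 1) 0 = H := by
      simp only [Fm.shift, Fm.app₂, Fm.ren_ren]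
      conv_rhs => rw [← H.ren_id]
      congr 1; funext n; rcases n with _ | n <;> rfl
    rw [e]
    exact k Δ fun {Θ} _ => by
      have := hB'' (Θ := Θ) hi
      rwa [Fm.inst_shift] at this
  refine ruled_mono h fun Ξ _ Y _ hY => ?_
  refine impI (φ := ψ.shift.inst Y) fun Δ _ hp => ?_
  have h₁ : Δ ⊩ X ∈ˢ B := hB (fst hA) (by
    have := hp (Θ := Δ)
    rw [Fm.inst_shift] at this ⊢
    exact this)
  have h₂ := ballE (φ := H.shift.ren (liftRen (instRen Y))) hY h₁
  have e : (H.shift.ren (liftRen (instRen Y))).inst X = H.inst Y := by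
    rw [Fm.ren_shift, Fm.inst_shift]; rfl
  exact (e ▸ h₂ : Δ ⊩ H.inst Y)

/-- The class of rules on `X` under which all members of the class `G` are closed. -/
def validRule (X : ℕ) (G : Fm) : Fm :=
  .ex (.ex (isOPair 2 1 0 ∧ˢ sub 1 (X + 3) ∧ˢ sub 0 (X + 3) ∧ˢ
    .all (G.app₁ 4 0 →ˢ sub 2 0 →ˢ bex 1 (0 ∈ˢ 1))))

theorem validRuleI {X r a b : ℕ} {G : Fm} (hr : Γ ⊩ isOPair r a b) (ha : Γ ⊩ sub a X)
    (hb : Γ ⊩ sub b X)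
    (k : ∀ Δ [Le Γ Δ] Y, (Δ ⊫ G.inst Y) → (Δ ⊫ sub a Y) → Δ ⊩ bex b (0 ∈ˢ Y + 1)) :
    Γ ⊩ (validRule X G).inst r := by
  refine exI a (exI b (both hr (both ha (both hb (allI fun Y => impI fun Δ _ hY =>
    impI fun Θ _ h => k Θ Y ?_ h)))))
  intro Ξ _
  have h₁ := hY (Θ := Ξ)
  simp only [Fm.app₁, Fm.inst, Fm.ren_ren] at h₁ ⊢
  convert h₁ using 2
  funext n; rcases n with _ | n <;> rfl

theorem validRuleE {X r : ℕ} {G χ : Fm} (h : Γ ⊩ (validRule X G).inst r)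
    (k : ∀ Δ [Le Γ Δ] a b, (Δ ⊫ isOPair r a b) → (Δ ⊫ sub a X) → (Δ ⊫ sub b X) →
      (∀ {Θ : List Fm} [Le Δ Θ] {Y : ℕ}, (Θ ⊩ G.inst Y) → (Θ ⊩ sub a Y) →
        Θ ⊩ bex b (0 ∈ˢ Y + 1)) → Δ ⊩ χ) : Γ ⊩ χ := by
  refine exE h fun _ _ a ha => exE ha fun Δ _ b hb => ?_
  refine k Δ a b (fst hb) (fst (snd hb)) (fst (snd (snd hb))) fun {Θ} _ {Y} hY h => ?_
  have h₁ : Θ ⊩ (_ →ˢ sub a Y →ˢ bex b (0 ∈ˢ Y + 1)) := allE (snd (snd (snd hb))) Y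
  refine mp (mp h₁ ?_) h
  simp only [Fm.app₁, Fm.inst, Fm.ren_ren] at hY ⊢
  convert hY using 2
  funext n; rcases n with _ | n <;> rfl

/-- The atomic case: the singleton of the rule (a, b) suffices. -/
theorem ruled_rule {X a b : ℕ} {G : Fm} (ha : Γ ⊫ sub a X) (hb : Γ ⊫ sub b X)
    (k : ∀ Δ [Le Γ Δ] Y, (Δ ⊫ G.inst Y) → (Δ ⊫ sub a Y) → Δ ⊩ bex b (0 ∈ˢ Y + 1)) :
    Γ ⊩ ruled X (validRule X G) (sub (a + 1) 0 →ˢ bex (b + 1) (0 ∈ˢ 1)) := by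
  refine opairE a b fun _ _ r hr => upairE r r fun Θ _ R hR => ruledI R (fun Ξ _ s hs => ?_)
    fun _ _ Y hY => impI fun _ _ h => isClosedE hY (relI (fst hR) hr) h
  exact validRuleI (subst (isOPair 0 (a + 1) (b + 1)) (symm (singletonE hR hs)) hr) ha hb
    fun Δ _ Y hY h => @k Δ inferInstance Y hY h

/-- The class `H` is generated, for the members of the class `G`, by a set. -/
theorem ruled_generates {X : ℕ} {G H χ : Fm} (hNID : Γ ⊫ NID)
    (h : Γ ⊩ ruled X (validRule X G) H)
    (k : ∀ Δ [Le Γ Δ] C,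
      (∀ {Θ : List Fm} [Le Δ Θ] {Y : ℕ}, (Θ ⊩ Y ∈ˢ C) → Θ ⊩ sub Y X) →
      (∀ {Θ : List Fm} [Le Δ Θ] {Y : ℕ}, (Θ ⊩ Y ∈ˢ C) → Θ ⊩ H.inst Y) →
      (∀ {Θ : List Fm} [Le Δ Θ] {Y a : ℕ}, (Θ ⊫ G.inst Y) → (Θ ⊫ sub Y X) → (Θ ⊫ a ∈ˢ Y) →
        Θ ⊩ bex C (a + 1 ∈ˢ 0 ∧ˢ sub 0 (Y + 1))) → Δ ⊩ χ) : Γ ⊩ χ := by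
  refine ruledE h fun Ξ _ R hV hH => ?_
  have h₁ : Ξ ⊩ .all (isRules (X + 1) 0 →ˢ .ex (ball 0 (isClosed 0 (X + 3) 2) ∧ˢ
      .all (isClosed 0 (X + 3) 2 →ˢ ball 0 (bex 2 (1 ∈ˢ 0 ∧ˢ sub 0 2))))) := allE hNID X
  have h₂ : Ξ ⊩ isRules X R →ˢ .ex (ball 0 (isClosed 0 (X + 2) (R + 2)) ∧ˢ
      .all (isClosed 0 (X + 2) (R + 2) →ˢ ball 0 (bex 2 (1 ∈ˢ 0 ∧ˢ sub 0 2)))) := allE h₁ R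
  refine exE (mp h₂ (ballI fun _ _ r hr => validRuleE (hV hr) fun _ _ a b hr ha hb _ =>
    exI a (exI b (both hr (both ha hb))))) fun Δ _ C (hC : Δ ⊫ ball C (isClosed 0 (X + 1) (R + 1)) ∧ˢ
      .all (isClosed 0 (X + 1) (R + 1) →ˢ ball 0 (bex (C + 2) (1 ∈ˢ 0 ∧ˢ sub 0 2)))) => ?_
  refine k Δ C (fun {Θ} _ {Y} hY => ?_) (fun {Θ} _ {Y} hY => ?_) (fun {Θ} _ {Y a} hY hYX ha => ?_)
  · have h₃ : Θ ⊩ isClosed Y X R := ballE (fst hC) hY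
    exact fst h₃
  · have h₃ : Θ ⊩ isClosed Y X R := ballE (fst hC) hY
    exact hH h₃
  · have h₃ : Θ ⊩ isClosed Y X R →ˢ ball Y (bex (C + 1) (1 ∈ˢ 0 ∧ˢ sub 0 (Y + 2))) :=
      allE (snd hC) Y
    -- A member of `G` is closed under `R` because every rule in `R` is valid for `G`, so the
    -- generators provided by NID apply to it.
    refine ballE (mp h₃ (isClosedI hYX fun _ _ c d hcd hc => ?_)) ha
    refine relE hcd fun _ _ r hr hcd => validRuleE (hV hr) fun _ _ c' d' hcd' _ _ hv => ?_
    exact subst (bex 0 (0 ∈ˢ Y + 2)) (opair_snd hcd' hcd)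
      (hv hY (subst (sub 0 (Y + 1)) (opair_fst hcd hcd') hc))

/-! ### Set-presented formal spaces -/

theorem le_refl {P L x : ℕ} (h : Γ ⊩ isPreorder P L) (hx : Γ ⊩ x ∈ˢ P) : Γ ⊩ rel L x x :=
  ballE (fst h) hx

theorem le_trans {P L x y z : ℕ} (h : Γ ⊩ isPreorder P L) (hx : Γ ⊩ x ∈ˢ P) (hy : Γ ⊩ y ∈ˢ P)
    (hz : Γ ⊩ z ∈ˢ P) (hxy : Γ ⊩ rel L x y) (hyz : Γ ⊩ rel L y z) : Γ ⊩ rel L x z := by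
  have h₁ : Γ ⊩ ball P (ball (P + 1) (rel (L + 2) (x + 2) 1 →ˢ rel (L + 2) 1 0 →ˢ
    rel (L + 2) (x + 2) 0)) := ballE (snd h) hx
  have h₂ : Γ ⊩ ball P (rel (L + 1) (x + 1) (y + 1) →ˢ rel (L + 1) (y + 1) 0 →ˢ
    rel (L + 1) (x + 1) 0) := ballE h₁ hy
  have h₃ : Γ ⊩ rel L x y →ˢ rel L y z →ˢ rel L x z := ballE h₂ hz
  exact mp (mp h₃ hxy) hyz

theorem isFun_total {f A x : ℕ} {χ : Fm} (h : Γ ⊩ isFun f A) (hx : Γ ⊩ x ∈ˢ A)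
    (k : ∀ Δ [Le Γ Δ] y, (Δ ⊫ rel f x y) → Δ ⊩ χ) : Γ ⊩ χ :=
  exE (ballE (fst (snd h)) hx) k

theorem isFun_unique {f A x y y' : ℕ} (h : Γ ⊩ isFun f A) (hx : Γ ⊩ x ∈ˢ A)
    (hy : Γ ⊩ rel f x y) (hy' : Γ ⊩ rel f x y') : Γ ⊩ y =ˢ y' := by
  have h₁ : Γ ⊩ .all (.all (rel (f + 2) (x + 2) 1 →ˢ rel (f + 2) (x + 2) 0 →ˢ 1 =ˢ 0)) :=
    ballE (snd (snd h)) hx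
  have h₂ : Γ ⊩ .all (rel (f + 1) (x + 1) (y + 1) →ˢ rel (f + 1) (x + 1) 0 →ˢ y + 1 =ˢ 0) :=
    allE h₁ y
  have h₃ : Γ ⊩ rel f x y →ˢ rel f x y' →ˢ y =ˢ y' := allE h₂ y'
  exact mp (mp h₃ hy) hy'

/-- `R ∈ B(p)` and `R ⊆ {x : x ≤ p}`. -/
def basic (B L p R : ℕ) : Fm :=
  .ex (rel (B + 1) (p + 1) 0 ∧ˢ R + 1 ∈ˢ 0 ∧ˢ ball (R + 1) (rel (L + 2) 0 (p + 2)))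

theorem basicI {B L p R c : ℕ} (hc : Γ ⊩ rel B p c) (hR : Γ ⊩ R ∈ˢ c)
    (h : Γ ⊩ ball R (rel (L + 1) 0 (p + 1))) : Γ ⊩ basic B L p R :=
  exI c (both hc (both hR h))

theorem basicE {B L p R : ℕ} {χ : Fm} (h : Γ ⊩ basic B L p R)
    (k : ∀ Δ [Le Γ Δ] c, (Δ ⊫ rel B p c) → (Δ ⊫ R ∈ˢ c) →
      (Δ ⊫ ball R (rel (L + 1) 0 (p + 1))) → Δ ⊩ χ) : Γ ⊩ χ :=
  exE h fun Δ _ c hc => k Δ c (fst hc) (fst (snd hc)) (snd (snd hc))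

/-- What is used of a set-presented formal space `(P, L, K)` with the function `B`. -/
structure Presented (Γ : List Fm) (P L B : ℕ) (K : Fm) : Prop where
  preorder : Γ ⊫ isPreorder P L
  isFun : Γ ⊫ isFun B P
  sub : ∀ {Θ : List Fm} [Le Γ Θ] {p c R : ℕ}, (Θ ⊩ p ∈ˢ P) → (Θ ⊩ rel B p c) → (Θ ⊩ R ∈ˢ c) →
    Θ ⊩ sub R P
  isSieve : ∀ {Θ : List Fm} [Le Γ Θ] {p S : ℕ}, (Θ ⊩ p ∈ˢ P) → (Θ ⊩ K.app₂ 0 p S) →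
    Θ ⊩ isSieve S p P L
  cov_iff : ∀ {Θ : List Fm} [Le Γ Θ] {p S : ℕ}, (Θ ⊩ p ∈ˢ P) → (Θ ⊩ CZF.isSieve S p P L) →
    Θ ⊩ K.app₂ 0 p S ↔ˢ .ex (rel (B + 1) (p + 1) 0 ∧ˢ bex 0 (CZF.sub 0 (S + 2)))

theorem Presented.mono {P L B : ℕ} {K : Fm} (h : Presented Γ P L B K) {Δ : List Fm} [Le Γ Δ] :
    Presented Δ P L B K where
  preorder := h.preorder
  isFun := h.isFun
  sub := h.sub
  isSieve := h.isSieve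
  cov_iff := h.cov_iff

theorem presentedE {P L : ℕ} {K χ : Fm} (hS : Γ ⊫ isFormalSpace P L K)
    (hP : Γ ⊫ isSetPresented P L K) (k : ∀ Δ [Le Γ Δ] B, Presented Δ P L B K → Δ ⊩ χ) :
    Γ ⊩ χ := by
  refine exE hP fun Δ _ B hB => k Δ B ⟨fst hS, fst hB, ?_, ?_, ?_⟩
  · intro Θ _ p c R hp hc hR
    have h₁ : Θ ⊩ .all (rel (B + 1) (p + 1) 0 →ˢ ball 0 (sub 0 (P + 2))) :=
      ballE (fst (snd hB)) hp
    have h₂ : Θ ⊩ rel B p c →ˢ ball c (sub 0 (P + 1)) := allE h₁ c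
    exact ballE (mp h₂ hc) hR
  · intro Θ _ p S hp hK
    have h₁ := ballE (fst (snd hS)) hp
    have h₂ : Θ ⊩ _ →ˢ isSieve S p P L := allE h₁ S
    refine mp h₂ ?_
    convert! hK using 1
    simp only [Fm.app₂, Fm.ren_ren]
    congr 1; funext n; rcases n with _ | _ | n <;> rfl
  · intro Θ _ p S hp hSv
    have h₁ := ballE (snd (snd hB)) hp
    have e : (((K.app₂ 3 1 0).ren (liftRen (liftRen (instRen B)))).ren (liftRen (instRen p))).ren
        (instRen S) = K.app₂ 0 p S := by
      simp only [Fm.app₂, Fm.ren_ren]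
      congr 1; funext n; rcases n with _ | _ | n <;> rfl
    rw [← e]
    have h₂ : Θ ⊩ isSieve S p P L →ˢ (_ ↔ˢ _) := allE h₁ S
    exact mp h₂ hSv

/-- If `S ∈ Cov(p)`, then `R ⊆ S` for some basic cover `R` of `p`. -/
theorem Presented.basicE {P L B p S : ℕ} {K χ : Fm} (h : Presented Γ P L B K)
    (hp : Γ ⊫ p ∈ˢ P) (hS : Γ ⊫ K.app₂ 0 p S)
    (k : ∀ Δ [Le Γ Δ] R, (Δ ⊫ basic B L p R) → (Δ ⊫ CZF.sub R S) → Δ ⊩ χ) : Γ ⊩ χ := by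
  refine exE (mp (fst (h.cov_iff hp (h.isSieve hp hS))) hS) fun _ _ c hc => ?_
  refine bexE (snd hc) fun Δ _ R hR hRS => ?_
  -- A member of B(p) need not lie below p in general; this one does, being contained in a sieve on
  -- p.
  refine k Δ R (basicI (fst hc) hR (ballI fun Θ _ x hx => ?_)) hRS
  exact ballE (fst (snd (h.isSieve hp hS))) (subE hRS hx)

/-- A basic cover `R` of `p` generates a sieve in `Cov(p)`. -/
theorem Presented.coverE {P L B p R : ℕ} {K χ : Fm} (h : Presented Γ P L B K)
    (hp : Γ ⊫ p ∈ˢ P) (hR : Γ ⊫ basic B L p R)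
    (k : ∀ Δ [Le Γ Δ] S, (Δ ⊫ K.app₂ 0 p S) →
      (∀ {Θ : List Fm} [Le Δ Θ] {x : ℕ}, (Θ ⊩ x ∈ˢ S) → Θ ⊩ x ∈ˢ P) →
      (∀ {Θ : List Fm} [Le Δ Θ] {x : ℕ}, (Θ ⊩ x ∈ˢ S) → Θ ⊩ bex R (rel (L + 1) (x + 1) 0)) →
      Δ ⊩ χ) : Γ ⊩ χ := by
  refine CZF.basicE hR fun Ω _ c hc hRc hle => ?_
  have hsub : Ω ⊫ CZF.sub R P := h.sub hp hc hRc
  -- The cover is the downward closure of R in P. It is a sieve on p because the elements of R lie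
  -- below p.
  refine sepE (bex (R + 1) (rel (L + 2) 1 0)) (.bex _ (bounded_rel _ _ _)) P
    fun Δ _ S hS hSP hS' => ?_
  have hS'' : ∀ {Θ : List Fm} [Le Δ Θ] {x : ℕ}, (Θ ⊩ x ∈ˢ S) →
    Θ ⊩ bex R (rel (L + 1) (x + 1) 0) := fun h => hS' h
  refine k Δ S (mp (snd (h.cov_iff hp (both (subI fun _ _ _ hx => hSP hx) (both ?_ ?_)))) ?_)
    hSP hS''
  · refine ballI fun _ _ x hx => bexE (hS'' hx) fun Θ _ r hr (hxr : Θ ⊫ rel L x r) => ?_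
    exact le_trans h.preorder (hSP hx) (subE hsub hr) hp hxr (ballE hle hr)
  · refine ballI fun _ _ x hx => ballI fun _ _ y hy => impI fun Ξ _ (hyx : Ξ ⊫ rel L y x) => ?_
    refine bexE (hS'' hx) fun Θ _ r hr (hxr : Θ ⊫ rel L x r) => ?_
    exact hS hy (bexI r hr (le_trans h.preorder hy (hSP hx) (subE hsub hr) hyx hxr))
  · refine exI c (both hc (bexI R hRc (subI fun _ _ x hx => ?_)))
    exact hS (subE hsub hx) (bexI x hx (le_refl h.preorder (subE hsub hx)))

/-- There is a set of subsets of `P` that contains all basic covers. -/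
theorem Presented.basicSetE {P L B : ℕ} {K χ : Fm} (h : Presented Γ P L B K)
    (k : ∀ Δ [Le Γ Δ] U,
      (∀ {Θ : List Fm} [Le Δ Θ] {p R : ℕ}, (Θ ⊫ p ∈ˢ P) → (Θ ⊫ basic B L p R) → Θ ⊩ R ∈ˢ U) →
      (∀ {Θ : List Fm} [Le Δ Θ] {R : ℕ}, (Θ ⊫ R ∈ˢ U) → Θ ⊩ CZF.sub R P) → Δ ⊩ χ) : Γ ⊩ χ := by
  refine collE (rel (B + 2) 0 1) P (fun _ _ p hp => isFun_total h.isFun hp fun _ _ c hc => exI c hc)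
    fun _ _ C hC hC' => unionE C fun Δ _ U hU hU' => k Δ U ?_ ?_
  · intro Θ _ p R hp hR
    refine CZF.basicE hR fun _ _ c hc hRc _ => ?_
    refine bexE (hC hp) fun Ξ _ c' hc' (h' : Ξ ⊫ rel B p c') => ?_
    exact hU (mem_of_mem_eq (isFun_unique h.isFun hp hc h') hRc) hc'
  · intro Θ _ R hR
    refine bexE (hU' hR) fun _ _ c hc (hRc : _ ⊫ R ∈ˢ c) => ?_
    refine bexE (hC' hc) fun Ξ _ p hp (h' : Ξ ⊫ rel B p c) => ?_
    exact h.sub hp h' hRc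

/-! ### Morphisms -/

/-- There is a basic cover `R` of `p` such that each `r ∈ R` is related by `F` to some `q ∈ D`. -/
def hasCover (B L F p D : ℕ) : Fm :=
  .ex (basic (B + 1) (L + 1) (p + 1) 0 ∧ˢ ball 0 (bex (D + 2) (rel (F + 3) 1 0)))

/-- `D = {q ∈ Q : q ≤ q₀, q ≤ q₁}`. -/
def isMeet (D q₀ q₁ Q L' : ℕ) : Fm :=
  .all (0 ∈ˢ D + 1 ↔ˢ 0 ∈ˢ Q + 1 ∧ˢ rel (L' + 1) 0 (q₀ + 1) ∧ˢ rel (L' + 1) 0 (q₁ + 1))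

/-- A renaming that only changes the quantifier depth of the parameters leaves the classes K and K'
as they are. -/
theorem isMorphism_ren {d d' : ℕ} (F P L Q L' : ℕ) (K K' : Fm) {ρ : ℕ → ℕ}
    (h : ∀ n, ρ (n + d) = n + d') :
    (isMorphism d F P L K Q L' K').ren ρ =
      isMorphism d' (ρ F) (ρ P) (ρ L) K (ρ Q) (ρ L') K' := by
  have e : ∀ (A : Fm) (c c' x y : ℕ) (σ : ℕ → ℕ), (∀ n, σ (n + c) = n + c') →
      (A.app₂ c x y).ren σ = A.app₂ c' (σ x) (σ y) := fun A c c' x y σ hσ => by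
    simp only [Fm.app₂, Fm.ren_ren]
    congr 1; funext n; rcases n with _ | _ | n
    · rfl
    · rfl
    · exact hσ n
  have e₂ : ∀ (A : Fm) (x y : ℕ), (A.app₂ (d + 2) x y).ren (liftRen (liftRen ρ)) =
      A.app₂ (d' + 2) (liftRen (liftRen ρ) x) (liftRen (liftRen ρ) y) :=
    fun A x y => e A _ _ x y _ fun n => by rw [← add_assoc]; simp [liftRen, h]; rfl
  have e₃ : ∀ (A : Fm) (x y : ℕ), (A.app₂ (d + 3) x y).ren (liftRen (liftRen (liftRen ρ))) =
      A.app₂ (d' + 3) (liftRen (liftRen (liftRen ρ)) x) (liftRen (liftRen (liftRen ρ)) y) :=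
    fun A x y => e A _ _ x y _ fun n => by rw [← add_assoc]; simp [liftRen, h]; rfl
  have e₄ : ∀ (A : Fm) (x y : ℕ),
      (A.app₂ (d + 4) x y).ren (liftRen (liftRen (liftRen (liftRen ρ)))) =
        A.app₂ (d' + 4) (liftRen (liftRen (liftRen (liftRen ρ))) x)
          (liftRen (liftRen (liftRen (liftRen ρ))) y) :=
    fun A x y => e A _ _ x y _ fun n => by rw [← add_assoc]; simp [liftRen, h]; rfl
  simp only [isMorphism, Fm.ren, ball, bex, e₂, e₃, e₄]
  rfl

/-! ### The conditions on a morphism in terms of basic covers -/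

variable {P L B Q L' B' F : ℕ} {K K' : Fm}

theorem morphism_pair {z : ℕ} {χ : Fm} (h : Γ ⊩ isMorphism 0 F P L K Q L' K') (hz : Γ ⊩ z ∈ˢ F)
    (k : ∀ Δ [Le Γ Δ] p q, (Δ ⊫ p ∈ˢ P) → (Δ ⊫ q ∈ˢ Q) → (Δ ⊫ isOPair z p q) → Δ ⊩ χ) :
    Γ ⊩ χ :=
  bexE (ballE (fst h) hz) fun _ _ p hp hp' => bexE hp' fun Δ _ q hq h => k Δ p q hp hq h

theorem morphism_mono {p p' q q' : ℕ} (h : Γ ⊩ isMorphism 0 F P L K Q L' K')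
    (hp : Γ ⊩ p ∈ˢ P) (hp' : Γ ⊩ p' ∈ˢ P) (hq : Γ ⊩ q ∈ˢ Q) (hq' : Γ ⊩ q' ∈ˢ Q)
    (hF : Γ ⊩ rel F p q) (hl : Γ ⊩ rel L p' p) (hl' : Γ ⊩ rel L' q q') : Γ ⊩ rel F p' q' := by
  have h₁ : Γ ⊩ ball P (ball (Q + 1) (ball (Q + 2) (rel (F + 3) (p + 3) 1 →ˢ
    rel (L + 3) 2 (p + 3) →ˢ rel (L' + 3) 1 0 →ˢ rel (F + 3) 2 0))) := ballE (fst (snd h)) hp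
  have h₂ : Γ ⊩ ball Q (ball (Q + 1) (rel (F + 2) (p + 2) 1 →ˢ
    rel (L + 2) (p' + 2) (p + 2) →ˢ rel (L' + 2) 1 0 →ˢ rel (F + 2) (p' + 2) 0)) := ballE h₁ hp'
  have h₃ : Γ ⊩ ball Q (rel (F + 1) (p + 1) (q + 1) →ˢ rel (L + 1) (p' + 1) (p + 1) →ˢ
    rel (L' + 1) (q + 1) 0 →ˢ rel (F + 1) (p' + 1) 0) := ballE h₂ hq
  have h₄ : Γ ⊩ rel F p q →ˢ rel L p' p →ˢ rel L' q q' →ˢ rel F p' q' := ballE h₃ hq'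
  exact mp (mp (mp h₄ hF) hl) hl'

/-- Monotonicity of F carries the relation to q from R to the sieve generated by R, where condition
(2) applies. -/
theorem morphism_local {p q R : ℕ} (hP : Presented Γ P L B K) (hQ : Γ ⊫ isPreorder Q L')
    (h : Γ ⊫ isMorphism 0 F P L K Q L' K') (hp : Γ ⊫ p ∈ˢ P) (hq : Γ ⊫ q ∈ˢ Q)
    (hR : Γ ⊫ basic B L p R) (hRP : Γ ⊫ sub R P) (hF : Γ ⊫ ball R (rel (F + 1) 0 (q + 1))) :
    Γ ⊩ rel F p q := by
  refine hP.coverE hp hR fun Δ _ S hS hSP hS' => ?_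
  have h₁ := ballE (ballE (Γ := Δ) (fst (snd (snd h))) hq) hp
  have h₂ : Δ ⊩ _ →ˢ ball S (rel (F + 1) 0 (q + 1)) →ˢ rel F p q := allE h₁ S
  refine mp (mp h₂ ?_) (ballI fun _ _ x hx => ?_)
  · convert! hS (Θ := Δ) using 1
    simp only [Fm.app₂, Fm.ren_ren]
    congr 1; funext n; rcases n with _ | _ | n <;> rfl
  · refine bexE (hS' hx) fun Θ _ r hr (hxr : Θ ⊫ rel L x r) => ?_
    exact morphism_mono h (subE hRP hr) (hSP hx) hq hq (ballE hF hr) hxr (le_refl hQ hq)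

theorem hasCoverI {p D R : ℕ} (hR : Γ ⊩ basic B L p R)
    (h : Γ ⊩ ball R (bex (D + 1) (rel (F + 2) 1 0))) : Γ ⊩ hasCover B L F p D :=
  exI R (both hR h)

theorem morphism_total {p : ℕ} (hP : Presented Γ P L B K)
    (h : Γ ⊫ isMorphism 0 F P L K Q L' K') (hp : Γ ⊫ p ∈ˢ P) : Γ ⊩ hasCover B L F p Q := by
  have h₁ := ballE (Γ := Γ) (fst (snd (snd (snd h)))) hp
  refine exE h₁ fun Δ _ S hS => ?_
  have hK : Δ ⊫ K.app₂ 0 p S := by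
    intro Θ _
    convert! fst (hS (Θ := Θ)) using 1
    simp only [Fm.app₂, Fm.ren_ren]
    congr 1; funext n; rcases n with _ | _ | n <;> rfl
  have hS' : Δ ⊫ ball S (bex (Q + 1) (rel (F + 2) 1 0)) := snd hS
  refine Presented.basicE (Γ := Δ) hP.mono hp hK fun _ _ R hR hRS =>
    hasCoverI hR (ballI fun _ _ r hr => ?_)
  exact ballE hS' (subE hRS hr)

theorem morphism_meet {p q₀ q₁ D : ℕ} (hP : Presented Γ P L B K)
    (h : Γ ⊫ isMorphism 0 F P L K Q L' K') (hp : Γ ⊫ p ∈ˢ P) (hq₀ : Γ ⊫ q₀ ∈ˢ Q)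
    (hq₁ : Γ ⊫ q₁ ∈ˢ Q) (h₀ : Γ ⊫ rel F p q₀) (h₁ : Γ ⊫ rel F p q₁)
    (hD : Γ ⊫ isMeet D q₀ q₁ Q L') : Γ ⊩ hasCover B L F p D := by
  have h₂ := ballE (Γ := Γ) (ballE (ballE (fst (snd (snd (snd (snd h))))) hq₀) hq₁) hp
  have h₃ : Γ ⊩ rel F p q₀ →ˢ rel F p q₁ →ˢ .ex _ := h₂
  refine exE (mp (mp h₃ h₀) h₁) fun Δ _ S hS => ?_
  have hK : Δ ⊫ K.app₂ 0 p S := by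
    intro Θ _
    convert! fst (hS (Θ := Θ)) using 1
    simp only [Fm.app₂, Fm.ren_ren]
    congr 1; funext n; rcases n with _ | _ | n <;> rfl
  have hS' : Δ ⊫ ball S (bex (Q + 1) (rel (F + 2) 1 0 ∧ˢ rel (L' + 2) 0 (q₀ + 2) ∧ˢ
    rel (L' + 2) 0 (q₁ + 2))) := snd hS
  refine Presented.basicE (Γ := Δ) hP.mono hp hK fun _ _ R hR hRS =>
    hasCoverI hR (ballI fun Θ _ r hr => ?_)
  have h₄ : Θ ⊩ bex Q (rel (F + 1) (r + 1) 0 ∧ˢ rel (L' + 1) 0 (q₀ + 1) ∧ˢ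
    rel (L' + 1) 0 (q₁ + 1)) := ballE hS' (subE hRS hr)
  refine bexE h₄ fun Ξ _ q hq
    (h : Ξ ⊫ rel F r q ∧ˢ rel L' q q₀ ∧ˢ rel L' q q₁) => bexI q ?_ (fst h)
  exact mp (snd (allE hD q)) (both hq (snd h))

/-- Condition (5) is applied to the sieve generated by T; each of its elements lies below some t ∈
T, to which monotonicity in Q moves the relation. -/
theorem morphism_cover {p q T : ℕ} (hP : Presented Γ P L B K) (hQ : Presented Γ Q L' B' K')
    (h : Γ ⊫ isMorphism 0 F P L K Q L' K') (hp : Γ ⊫ p ∈ˢ P) (hq : Γ ⊫ q ∈ˢ Q)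
    (hF : Γ ⊫ rel F p q) (hT : Γ ⊫ basic B' L' q T) (hTQ : Γ ⊫ sub T Q) :
    Γ ⊩ hasCover B L F p T := by
  refine hQ.coverE hq hT fun Ξ _ T' hT' hTQ' hTT' => ?_
  have h₁ := ballE (ballE (Γ := Ξ) (snd (snd (snd (snd (snd h))))) hp) hq
  have h₂ : Ξ ⊩ rel F p q →ˢ .all _ := h₁
  have h₃ := allE (mp h₂ hF) T'
  have h₄ : Ξ ⊩ _ →ˢ .ex _ := h₃
  refine exE (mp h₄ ?_) fun Δ _ S hS => ?_
  · convert! hT' (Θ := Ξ) using 1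
    simp only [Fm.app₂, Fm.ren_ren]
    congr 1; funext n; rcases n with _ | _ | n <;> rfl
  have hK : Δ ⊫ K.app₂ 0 p S := by
    intro Θ _
    convert! fst (hS (Θ := Θ)) using 1
    simp only [Fm.app₂, Fm.ren_ren]
    congr 1; funext n; rcases n with _ | _ | n <;> rfl
  have hS' : Δ ⊫ ball S (bex (T' + 1) (rel (F + 2) 1 0)) := snd hS
  refine Presented.basicE (Γ := Δ) hP.mono hp hK fun _ _ R hR hRS =>
    hasCoverI hR (ballI fun Θ _ r hr => ?_)
  have h₅ : Θ ⊩ bex T' (rel (F + 1) (r + 1) 0) := ballE hS' (subE hRS hr)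
  refine bexE h₅ fun Θ' _ q' hq' (hr' : Θ' ⊫ rel F r q') => ?_
  refine bexE (hTT' hq') fun Ω _ t ht (hl : Ω ⊫ rel L' q' t) => bexI t ht ?_
  have hrP : Ω ⊩ r ∈ˢ P := subE (fst (hP.isSieve hp hK)) (subE hRS hr)
  exact morphism_mono h hrP hrP (hTQ' hq') (subE hTQ ht) hr' (le_refl hP.preorder hrP) hl

/-! ### The carrier of the rules -/

/-- `z = (P, (R, D))`, where `(R, D) ∈ T`. As `P ∉ P`, such a `z` is not in `P × Q`. -/
def isTag (T P z R D : ℕ) : Fm :=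
  bex T (isOPair 0 (R + 1) (D + 1) ∧ˢ isOPair (z + 1) (P + 1) 0)

theorem bounded_isTag (T P z R D : ℕ) : Bounded (isTag T P z R D) :=
  .bex _ (.and (bounded_isOPair _ _ _) (bounded_isOPair _ _ _))

theorem isTagE {T P z R D : ℕ} {χ : Fm} (h : Γ ⊩ isTag T P z R D)
    (k : ∀ Δ [Le Γ Δ] t, (Δ ⊫ t ∈ˢ T) → (Δ ⊫ isOPair t R D) → (Δ ⊫ isOPair z P t) → Δ ⊩ χ) :
    Γ ⊩ χ :=
  bexE h fun Δ _ t ht h => k Δ t ht (fst h) (snd h)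

theorem isTag_inj {T P z R D R' D' : ℕ} {χ : Fm} (h : Γ ⊫ isTag T P z R D)
    (h' : Γ ⊫ isTag T P z R' D') (k : ∀ Δ [Le Γ Δ], (Δ ⊫ R =ˢ R') → (Δ ⊫ D =ˢ D') → Δ ⊩ χ) :
    Γ ⊩ χ := by
  refine isTagE h fun _ _ t _ ht hz => isTagE h' fun Δ _ t' _ ht' hz' => ?_
  have e : Δ ⊫ isOPair t' R D := subst (isOPair 0 (R + 1) (D + 1)) (opair_snd hz hz') ht
  exact k Δ (opair_fst e ht') (opair_snd e ht')

theorem isTag_ne_pair {T P z R D p q : ℕ} {χ : Fm} (h : Γ ⊫ isTag T P z R D)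
    (hp : Γ ⊫ p ∈ˢ P) (hz : Γ ⊫ isOPair z p q) : Γ ⊩ χ :=
  isTagE h fun _ _ _ _ _ hz' => not_mem_self P (mem_of_eq (opair_fst hz hz') hp)

/-- The set `U` contains the basic covers of `P`, the set `V` contains `Q`, the binary meets in `Q`
and the basic covers of `Q`, the set `T` contains `U × V`, and `X` contains `P × Q` and
`{P} × T`. -/
structure Carrier (Γ : List Fm) (P L B Q L' B' U V T X : ℕ) : Prop where
  basic_mem : ∀ {Θ : List Fm} [Le Γ Θ] {p R : ℕ}, (Θ ⊫ p ∈ˢ P) → (Θ ⊫ basic B L p R) →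
    Θ ⊩ R ∈ˢ U
  sub_of_mem : ∀ {Θ : List Fm} [Le Γ Θ] {R : ℕ}, (Θ ⊫ R ∈ˢ U) → Θ ⊩ sub R P
  self_mem : Γ ⊫ Q ∈ˢ V
  basic_mem' : ∀ {Θ : List Fm} [Le Γ Θ] {q D : ℕ}, (Θ ⊫ q ∈ˢ Q) → (Θ ⊫ basic B' L' q D) →
    Θ ⊩ D ∈ˢ V
  meet_mem : ∀ {Θ : List Fm} [Le Γ Θ] {q₀ q₁ : ℕ}, (Θ ⊫ q₀ ∈ˢ Q) → (Θ ⊫ q₁ ∈ˢ Q) →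
    Θ ⊩ bex V (isMeet 0 (q₀ + 1) (q₁ + 1) (Q + 1) (L' + 1))
  sub_of_mem' : ∀ {Θ : List Fm} [Le Γ Θ] {D : ℕ}, (Θ ⊫ D ∈ˢ V) → Θ ⊩ sub D Q
  pair_mem : ∀ {Θ : List Fm} [Le Γ Θ] {p q z : ℕ}, (Θ ⊫ p ∈ˢ P) → (Θ ⊫ q ∈ˢ Q) →
    (Θ ⊫ isOPair z p q) → Θ ⊩ z ∈ˢ X
  tag : ∀ {Θ : List Fm} [Le Γ Θ] {R D t : ℕ}, (Θ ⊫ R ∈ˢ U) → (Θ ⊫ D ∈ˢ V) →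
    (Θ ⊫ isOPair t R D) → Θ ⊩ t ∈ˢ T
  tag_mem : ∀ {Θ : List Fm} [Le Γ Θ] {t z : ℕ}, (Θ ⊫ t ∈ˢ T) → (Θ ⊫ isOPair z P t) → Θ ⊩ z ∈ˢ X

variable {U V T X Y : ℕ}

theorem Carrier.mono (h : Carrier Γ P L B Q L' B' U V T X) {Δ : List Fm} [Le Γ Δ] :
    Carrier Δ P L B Q L' B' U V T X where
  basic_mem := h.basic_mem
  sub_of_mem := h.sub_of_mem
  self_mem := h.self_mem
  basic_mem' := h.basic_mem'
  meet_mem := h.meet_mem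
  sub_of_mem' := h.sub_of_mem'
  pair_mem := h.pair_mem
  tag := h.tag
  tag_mem := h.tag_mem

theorem isMeetE (q₀ q₁ Q L' : ℕ) {χ : Fm}
    (k : ∀ Δ [Le Γ Δ] D, (Δ ⊫ isMeet D q₀ q₁ Q L') → Δ ⊩ χ) : Γ ⊩ χ := by
  refine sepE (rel (L' + 1) 0 (q₀ + 1) ∧ˢ rel (L' + 1) 0 (q₁ + 1))
    (.and (bounded_rel _ _ _) (bounded_rel _ _ _)) Q fun Δ _ D h₁ h₂ h₃ => k Δ D ?_
  intro Ω _
  refine allI fun x => both (impI fun _ _ hx => both (h₂ hx) (h₃ hx)) (impI fun Θ _ hx => ?_)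
  have h : Θ ⊩ x ∈ˢ Q ∧ˢ rel L' x q₀ ∧ˢ rel L' x q₁ := hx
  exact h₁ (fst h) (snd h)

theorem isMeet_sub {D q₀ q₁ Q L' : ℕ} (h : Γ ⊫ isMeet D q₀ q₁ Q L') : Γ ⊩ sub D Q :=
  subI fun _ _ x hx => fst (mp (fst (allE h x)) hx)

/-- There is a set of subsets of `Q` that contains all binary meets. -/
theorem meetSetE (Q L' : ℕ) {χ : Fm} (k : ∀ Δ [Le Γ Δ] M,
      (∀ {Θ : List Fm} [Le Δ Θ] {q₀ q₁ : ℕ}, (Θ ⊫ q₀ ∈ˢ Q) → (Θ ⊫ q₁ ∈ˢ Q) →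
        Θ ⊩ bex M (isMeet 0 (q₀ + 1) (q₁ + 1) (Q + 1) (L' + 1))) →
      (∀ {Θ : List Fm} [Le Δ Θ] {D : ℕ}, (Θ ⊫ D ∈ˢ M) → Θ ⊩ sub D Q) → Δ ⊩ χ) : Γ ⊩ χ := by
  refine collE (ball (Q + 2) (bex 2 (isMeet 0 2 1 (Q + 4) (L' + 4))) ∧ˢ ball 1 (sub 0 (Q + 3))) Q
    (fun _ _ q₀ hq₀ => ?_) fun _ _ C hC hC' => unionE C fun Δ _ M hM hM' => k Δ M ?_ ?_
  · refine collE (isMeet 1 (q₀ + 2) 0 (Q + 2) (L' + 2)) Q (fun Δ _ q₁ hq₁ => ?_)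
      fun _ _ M hM hM' => exI M (both (ballI fun Δ _ q₁ hq₁ => hM hq₁) (ballI fun Δ _ D hD => ?_))
    · exact isMeetE q₀ q₁ Q L' fun _ _ D hD => exI D hD
    · refine bexE (hM' hD) fun Δ _ q₁ hq₁ (h : Δ ⊫ isMeet D q₀ q₁ Q L') => ?_
      exact isMeet_sub h
  · intro Θ _ q₀ q₁ hq₀ hq₁
    refine bexE (hC hq₀) fun Δ _ M' hM'C h => ?_
    have h₁ : Δ ⊩ ball Q (bex (M' + 1) (isMeet 0 (q₀ + 2) 1 (Q + 2) (L' + 2))) := fst h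
    have h₂ : Δ ⊩ bex M' (isMeet 0 (q₀ + 1) (q₁ + 1) (Q + 1) (L' + 1)) := ballE h₁ hq₁
    exact bexE h₂ fun _ _ D hD h => bexI D (hM hD hM'C) h
  · intro Θ _ D hD
    refine bexE (hM' hD) fun _ _ M' hM'C (hDM : _ ⊫ D ∈ˢ M') => ?_
    refine bexE (hC' hM'C) fun Δ _ q₀ hq₀ h => ?_
    have h₁ : Δ ⊩ ball M' (sub 0 (Q + 1)) := snd h
    exact ballE h₁ hDM

/-- Apart from members of U and V being subsets of P and Q, only lower bounds on the sets are
required, so collection, products and unions suffice. -/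
theorem carrierE {χ : Fm} (hP : Presented Γ P L B K) (hQ : Presented Γ Q L' B' K')
    (k : ∀ Δ [Le Γ Δ] U V T X, Carrier Δ P L B Q L' B' U V T X → Δ ⊩ χ) : Γ ⊩ χ := by
  refine hP.basicSetE fun Ω _ U hU hUP => Presented.basicSetE (Γ := Ω) hQ.mono fun _ _ U' hU' hUQ => ?_
  refine meetSetE Q L' fun _ _ M hM hMQ => upairE Q Q fun _ _ S hS => ?_
  refine cupE U' M fun _ _ W hU'W hMW hW => cupE W S fun _ _ V hWV hSV hV => ?_
  refine prodE U V fun _ _ T hT => prodE P Q fun _ _ X₁ hX₁ => upairE P P fun _ _ S' hS' => ?_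
  refine prodE S' T fun _ _ X₂ hX₂ => cupE X₁ X₂ fun Δ _ X hX₁X hX₂X _ => k Δ U V T X ?_
  exact {
    basic_mem := hU
    sub_of_mem := hUP
    self_mem := subE hSV (fst hS)
    basic_mem' := fun hq hD => subE hWV (subE hU'W (hU' hq hD))
    meet_mem := fun hq₀ hq₁ => bexE (hM hq₀ hq₁) fun _ _ D hD h =>
      bexI D (subE hWV (subE hMW hD)) h
    sub_of_mem' := fun hD => orE (hV hD)
      (fun _ _ hD => orE (hW hD) (fun _ _ hD => hUQ hD) (fun _ _ hD => hMQ hD))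
      (fun _ _ hD => subI fun _ _ x hx => mem_of_mem_eq (singletonE hS hD) hx)
    pair_mem := fun hp hq hz => subE hX₁X (hX₁ hp hq hz)
    tag := hT
    tag_mem := fun ht hz => subE hX₂X (hX₂ (fst hS') ht hz) }

theorem Carrier.tagE {R D : ℕ} {χ : Fm} (h : Carrier Γ P L B Q L' B' U V T X) (hR : Γ ⊫ R ∈ˢ U)
    (hD : Γ ⊫ D ∈ˢ V) (k : ∀ Δ [Le Γ Δ] z, (Δ ⊫ z ∈ˢ X) → (Δ ⊫ isTag T P z R D) → Δ ⊩ χ) :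
    Γ ⊩ χ := by
  refine opairE R D fun _ _ t ht => opairE P t fun Δ _ z hz => k Δ z ?_ ?_
  · exact h.tag_mem (h.tag hR hD ht) hz
  · exact bexI t (h.tag hR hD ht) (both ht hz)

/-! ### The extension of a morphism to the carrier -/

/-- `z ∈ F`, or `z` is the tag of `(R, D)` and each `p ∈ R` is related by `F` to some `q ∈ D`. -/
def inExt (z F P U V T : ℕ) : Fm :=
  z ∈ˢ F ∨ˢ bex U (bex (V + 1) (isTag (T + 2) (P + 2) (z + 2) 1 0 ∧ˢ
    ball 1 (bex 1 (rel (F + 4) 1 0))))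

theorem bounded_inExt (z F P U V T : ℕ) : Bounded (inExt z F P U V T) :=
  .or (.mem _ _) (.bex _ (.bex _ (.and (bounded_isTag _ _ _ _ _)
    (.ball _ (.bex _ (bounded_rel _ _ _))))))

/-- `Y` consists of the `z ∈ X` in the extension of `F`. -/
def isExt (Y F X P U V T : ℕ) : Fm :=
  .all (0 ∈ˢ Y + 1 ↔ˢ 0 ∈ˢ X + 1 ∧ˢ inExt 0 (F + 1) (P + 1) (U + 1) (V + 1) (T + 1))

theorem isExtE (F X P U V T : ℕ) {χ : Fm}
    (k : ∀ Δ [Le Γ Δ] Y, (Δ ⊫ isExt Y F X P U V T) → Δ ⊩ χ) : Γ ⊩ χ := by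
  refine sepE (inExt 0 (F + 1) (P + 1) (U + 1) (V + 1) (T + 1)) (bounded_inExt _ _ _ _ _ _) X
    fun Δ _ Y h₁ h₂ h₃ => k Δ Y ?_
  intro Ω _
  refine allI fun z => both (impI fun _ _ hz => both (h₂ hz) (h₃ hz)) (impI fun Θ _ hz => ?_)
  have h : Θ ⊩ z ∈ˢ X ∧ˢ (inExt 0 (F + 1) (P + 1) (U + 1) (V + 1) (T + 1)).inst z := hz
  exact h₁ (fst h) (snd h)

theorem isExt_sub (h : Γ ⊫ isExt Y F X P U V T) : Γ ⊩ sub Y X :=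
  subI fun _ _ z hz => fst (mp (fst (allE h z)) hz)

theorem mem_ext_of_mem {z : ℕ} (h : Γ ⊩ isExt Y F X P U V T) (hz : Γ ⊩ z ∈ˢ X)
    (hz' : Γ ⊩ inExt z F P U V T) : Γ ⊩ z ∈ˢ Y :=
  mp (snd (allE h z)) (both hz hz')

theorem inExt_of_mem {z : ℕ} (h : Γ ⊩ isExt Y F X P U V T) (hz : Γ ⊩ z ∈ˢ Y) :
    Γ ⊩ inExt z F P U V T :=
  snd (mp (fst (allE h z)) hz)

theorem inExtE {z : ℕ} {χ : Fm} (h : Γ ⊩ inExt z F P U V T)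
    (k₁ : ∀ Δ [Le Γ Δ], (Δ ⊫ z ∈ˢ F) → Δ ⊩ χ)
    (k₂ : ∀ Δ [Le Γ Δ] R D, (Δ ⊫ isTag T P z R D) → (Δ ⊫ ball R (bex (D + 1) (rel (F + 2) 1 0))) →
      Δ ⊩ χ) : Γ ⊩ χ :=
  orE h k₁ fun _ _ h => bexE h fun _ _ R _ hR => bexE hR fun Δ _ D _ h => k₂ Δ R D (fst h) (snd h)

/-- The extension adds only tags, and no tag is a pair with first component in P. Hence F can be
recovered from its extension. -/
theorem rel_of_rel_ext {p q : ℕ} (hY : Γ ⊫ isExt Y F X P U V T) (hp : Γ ⊫ p ∈ˢ P)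
    (h : Γ ⊫ rel Y p q) : Γ ⊩ rel F p q :=
  relE h fun _ _ _ hz hpq => inExtE (inExt_of_mem hY hz) (fun _ _ hz => relI hz hpq)
    fun _ _ _ _ ht _ => isTag_ne_pair ht hp hpq

theorem Carrier.rel_ext {p q : ℕ} (hC : Carrier Γ P L B Q L' B' U V T X)
    (hY : Γ ⊫ isExt Y F X P U V T) (hp : Γ ⊫ p ∈ˢ P) (hq : Γ ⊫ q ∈ˢ Q) (h : Γ ⊫ rel F p q) :
    Γ ⊩ rel Y p q :=
  relE h fun _ _ _ hz hpq => relI (mem_ext_of_mem hY (hC.pair_mem hp hq hpq) (.orI₁ hz)) hpq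

theorem tag_mem_ext {z R D : ℕ} (hY : Γ ⊫ isExt Y F X P U V T) (hR : Γ ⊫ R ∈ˢ U)
    (hD : Γ ⊫ D ∈ˢ V) (hz : Γ ⊫ isTag T P z R D) (hzX : Γ ⊫ z ∈ˢ X)
    (h : Γ ⊫ ball R (bex (D + 1) (rel (F + 2) 1 0))) : Γ ⊩ z ∈ˢ Y :=
  mem_ext_of_mem hY hzX (.orI₂ (bexI R hR (bexI D hD (both hz h))))

/-- A tag cannot come from F ⊆ P × Q, so it was added as a true tag; injectivity of tagging
identifies the two pairs (R, D). -/
theorem rel_of_tag_mem_ext {z R D p : ℕ} (hM : Γ ⊫ isMorphism 0 F P L K Q L' K')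
    (hY : Γ ⊫ isExt Y F X P U V T) (hz : Γ ⊫ isTag T P z R D) (hzY : Γ ⊫ z ∈ˢ Y)
    (hp : Γ ⊫ p ∈ˢ R) : Γ ⊩ bex D (rel (F + 1) (p + 1) 0) := by
  refine inExtE (inExt_of_mem hY hzY) (fun _ _ hzF => ?_) fun _ _ R' D' hz' h => ?_
  · exact morphism_pair hM hzF fun _ _ _ _ hp _ hpq => isTag_ne_pair hz hp hpq
  · refine isTag_inj hz hz' fun Δ _ eR eD => ?_
    have h₁ : Δ ⊩ bex D' (rel (F + 1) (p + 1) 0) := ballE h (mem_of_mem_eq eR hp)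
    exact subst (bex 0 (rel (F + 2) (p + 2) 0)) (symm eD) h₁

/-! ### The rules for morphisms -/

/-- The class of extensions of morphisms. -/
def morphismExt (P L : ℕ) (K : Fm) (Q L' : ℕ) (K' : Fm) (U V T X : ℕ) : Fm :=
  .ex (isMorphism 2 0 (P + 2) (L + 2) K (Q + 2) (L' + 2) K' ∧ˢ
    isExt 1 0 (X + 2) (P + 2) (U + 2) (V + 2) (T + 2))

theorem isMorphism_inst_inst : ((isMorphism 2 0 (P + 2) (L + 2) K (Q + 2) (L' + 2) K').ren
    (liftRen (instRen Y))).ren (instRen F) = isMorphism 0 F P L K Q L' K' := by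
  rw [isMorphism_ren (d := 2) (d' := 1) (ρ := liftRen (instRen Y)) _ _ _ _ _ _ _ fun _ => rfl,
    isMorphism_ren (d := 1) (d' := 0) (ρ := instRen F) _ _ _ _ _ _ _ fun _ => rfl]
  rfl

theorem morphismExtI (hM : Γ ⊩ isMorphism 0 F P L K Q L' K') (hY : Γ ⊩ isExt Y F X P U V T) :
    Γ ⊩ (morphismExt P L K Q L' K' U V T X).inst Y := by
  refine exI F (both ?_ hY)
  rw [← isMorphism_inst_inst (Y := Y)] at hM
  exact hM

theorem morphismExtE {χ : Fm} (h : Γ ⊩ (morphismExt P L K Q L' K' U V T X).inst Y)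
    (k : ∀ Δ [Le Γ Δ] F, (Δ ⊫ isMorphism 0 F P L K Q L' K') → (Δ ⊫ isExt Y F X P U V T) →
      Δ ⊩ χ) : Γ ⊩ χ := by
  refine exE h fun Δ _ F hF => k Δ F ?_ (snd hF)
  intro Θ _
  rw [← isMorphism_inst_inst (Y := Y)]
  exact fst hF

theorem singleton_sub {a z Y : ℕ} (ha : Γ ⊫ isUPair a z z) (hz : Γ ⊫ z ∈ˢ Y) : Γ ⊩ sub a Y :=
  subI fun _ _ _ hx => mem_of_eq (symm (singletonE ha hx)) hz

/-- Condition (1) as the rule {(p, q)} → {(p', q')}. -/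
theorem ruled_upward {p p' q q' : ℕ} (hC : Carrier Γ P L B Q L' B' U V T X)
    (hp : Γ ⊫ p ∈ˢ P) (hp' : Γ ⊫ p' ∈ˢ P) (hq : Γ ⊫ q ∈ˢ Q) (hq' : Γ ⊫ q' ∈ˢ Q)
    (hl : Γ ⊫ rel L p' p) (hl' : Γ ⊫ rel L' q q') :
    Γ ⊩ ruled X (validRule X (morphismExt P L K Q L' K' U V T X))
      (rel 0 (p + 1) (q + 1) →ˢ rel 0 (p' + 1) (q' + 1)) := by
  refine opairE p q fun _ _ z hz => opairE p' q' fun _ _ w hw => ?_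
  refine upairE z z fun _ _ a ha => upairE w w fun Ω _ b hb => ?_
  have h : Ω ⊫ ruled X (validRule X (morphismExt P L K Q L' K' U V T X))
      (sub (a + 1) 0 →ˢ bex (b + 1) (0 ∈ˢ 1)) :=
    ruled_rule (singleton_sub ha (hC.pair_mem hp hq hz)) (singleton_sub hb (hC.pair_mem hp' hq' hw))
      fun _ _ Y hY haY => morphismExtE hY fun Δ _ F hM hF => by
        have h₁ : Δ ⊫ rel F p q := rel_of_rel_ext hF hp (relI (subE haY (fst ha)) hz)
        have h₂ : Δ ⊫ rel F p' q' := morphism_mono hM hp hp' hq hq' h₁ hl hl'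
        exact bexI w (fst hb) (mem_of_rel (Carrier.rel_ext hC.mono hF hp' hq' h₂) hw)
  refine ruled_mono h fun Δ _ Y _ (hY : Δ ⊫ sub a Y →ˢ bex b (0 ∈ˢ Y + 1)) => ?_
  refine impI fun Θ _ (hpq : Θ ⊫ rel Y p q) => ?_
  refine bexE (mp hY (singleton_sub ha (mem_of_rel hpq hz))) fun Ξ _ v hv (hvY : Ξ ⊫ v ∈ˢ Y) => ?_
  have : Ξ ⊩ rel Y p' q' := relI (mem_of_eq (singletonE hb hv) hvY) hw
  exact this

/-- Condition (2) for a basic cover, as the rule R × {q} → {(p, q)}. -/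
theorem ruled_local {p q R : ℕ} (hP : Presented Γ P L B K) (hQ : Presented Γ Q L' B' K')
    (hC : Carrier Γ P L B Q L' B' U V T X)
    (hp : Γ ⊫ p ∈ˢ P) (hq : Γ ⊫ q ∈ˢ Q) (hR : Γ ⊫ basic B L p R) :
    Γ ⊩ ruled X (validRule X (morphismExt P L K Q L' K' U V T X))
      (ball (R + 1) (rel 1 0 (q + 2)) →ˢ rel 0 (p + 1) (q + 1)) := by
  have hRP : Γ ⊫ sub R P := hC.sub_of_mem (hC.basic_mem hp hR)
  refine opairE p q fun _ _ w hw => upairE w w fun _ _ b hb => ?_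
  refine sepE (bex (R + 1) (isOPair 1 0 (q + 2))) (.bex _ (bounded_isOPair _ _ _)) X
    fun Ω _ a h₁ h₂ h₃ => ?_
  have h₃' : ∀ {Θ : List Fm} [Le Ω Θ] {x : ℕ}, (Θ ⊩ x ∈ˢ a) →
    Θ ⊩ bex R (isOPair (x + 1) 0 (q + 1)) := fun h => h₃ h
  have h : Ω ⊫ ruled X (validRule X (morphismExt P L K Q L' K' U V T X))
      (sub (a + 1) 0 →ˢ bex (b + 1) (0 ∈ˢ 1)) :=
    ruled_rule (subI fun _ _ x hx => h₂ hx) (singleton_sub hb (hC.pair_mem hp hq hw))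
      fun _ _ Y hY haY => morphismExtE hY fun Δ _ F hM hF => by
        have h₄ : Δ ⊫ ball R (rel (F + 1) 0 (q + 1)) := ballI fun _ _ r hr => by
          refine opairE r q fun Ξ _ z hz => ?_
          have hrP : Ξ ⊫ r ∈ˢ P := subE hRP hr
          have hza : Ξ ⊩ z ∈ˢ a := h₁ (hC.pair_mem hrP hq hz) (bexI r hr hz)
          have h₅ : Ξ ⊩ rel F r q := rel_of_rel_ext hF hrP (relI (subE haY (stable hza)) hz)
          exact h₅
        have h₂ : Δ ⊫ rel F p q :=
          morphism_local hP.mono hQ.preorder hM hp hq hR hRP h₄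
        exact bexI w (fst hb) (mem_of_rel (Carrier.rel_ext hC.mono hF hp hq h₂) hw)
  refine ruled_mono h fun Δ _ Y _ (hY : Δ ⊫ sub a Y →ˢ bex b (0 ∈ˢ Y + 1)) => ?_
  refine impI fun Θ _ (hpq : Θ ⊫ ball R (rel (Y + 1) 0 (q + 1))) => ?_
  refine bexE (mp hY (subI fun _ _ z hz => ?_)) fun Ξ _ v hv (hvY : Ξ ⊫ v ∈ˢ Y) => ?_
  · refine bexE (h₃' hz) fun Ξ _ r hr (hzr : Ξ ⊫ isOPair z r q) => ?_
    exact mem_of_rel (ballE hpq hr) hzr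
  · have : Ξ ⊩ rel Y p q := relI (mem_of_eq (singletonE hb hv) hvY) hw
    exact this

/-- `Y` contains the tag of `(R, D)` for some basic cover `R` of `p`. -/
def hasTag (B L P T Y p D : ℕ) : Fm :=
  .ex (basic (B + 1) (L + 1) (p + 1) 0 ∧ˢ bex (Y + 1) (isTag (T + 2) (P + 2) 0 1 (D + 2)))

/-- The common form of conditions (3)–(5): the premise a is empty, or consists of one or two pairs,
and the conclusion is the set of tags of (R, D) with R a basic cover of p. The rule is valid because
the cover supplied by a morphism makes one of these tags true. -/
theorem ruled_hasTag {p a D : ℕ} (hP : Presented Γ P L B K)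
    (hC : Carrier Γ P L B Q L' B' U V T X) (hp : Γ ⊫ p ∈ˢ P) (hD : Γ ⊫ D ∈ˢ V)
    (ha : Γ ⊫ sub a X)
    (k : ∀ Δ [Le Γ Δ] F Y, (Δ ⊫ isMorphism 0 F P L K Q L' K') → (Δ ⊫ isExt Y F X P U V T) →
      (Δ ⊫ sub a Y) → Δ ⊩ hasCover B L F p D) :
    Γ ⊩ ruled X (validRule X (morphismExt P L K Q L' K' U V T X))
      (sub (a + 1) 0 →ˢ hasTag (B + 1) (L + 1) (P + 1) (T + 1) 0 (p + 1) (D + 1)) := by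
  -- Fixing c = B(p) makes the description of the conclusion bounded; `basic` itself has an
  -- unbounded quantifier over the value of B.
  refine isFun_total hP.isFun hp fun _ _ c hc => ?_
  refine sepE (bex (c + 1) (ball 0 (rel (L + 3) 0 (p + 3)) ∧ˢ isTag (T + 2) (P + 2) 1 0 (D + 2)))
    (.bex _ (.and (.ball _ (bounded_rel _ _ _)) (bounded_isTag _ _ _ _ _))) X
    fun Ω _ b h₁ h₂ h₃ => ?_
  have h₃' : ∀ {Θ : List Fm} [Le Ω Θ] {x : ℕ}, (Θ ⊩ x ∈ˢ b) →
    Θ ⊩ bex c (ball 0 (rel (L + 2) 0 (p + 2)) ∧ˢ isTag (T + 1) (P + 1) (x + 1) 0 (D + 1)) :=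
    fun h => h₃ h
  have h : Ω ⊫ ruled X (validRule X (morphismExt P L K Q L' K' U V T X))
      (sub (a + 1) 0 →ˢ bex (b + 1) (0 ∈ˢ 1)) :=
    ruled_rule ha (subI fun _ _ x hx => h₂ hx)
      fun _ _ Y hY haY => morphismExtE hY fun Δ _ F hM hF => by
        refine exE (k Δ F Y hM hF haY) fun Θ _ R
          (hR : Θ ⊫ basic B L p R ∧ˢ ball R (bex (D + 1) (rel (F + 2) 1 0))) => ?_
        refine basicE (fst hR) fun Ξ _ c' hc' hRc' hle => ?_
        have hRU : Ξ ⊫ R ∈ˢ U := hC.basic_mem hp (fst hR)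
        have hCΞ : Carrier Ξ P L B Q L' B' U V T X := hC.mono
        refine hCΞ.tagE hRU hD fun Δ _ z hzX hz => ?_
        refine bexI z (h₁ hzX (bexI R ?_ (both hle hz))) (tag_mem_ext hF hRU hD hz hzX (snd hR))
        exact mem_of_mem_eq (isFun_unique hP.isFun hp hc' hc) hRc'
  refine ruled_mono h fun Δ _ Y _ (hY : Δ ⊫ sub a Y →ˢ bex b (0 ∈ˢ Y + 1)) => ?_
  refine impI fun Θ _ (haY : Θ ⊫ sub a Y) => ?_
  refine bexE (mp hY haY) fun _ _ z hz (hzY : _ ⊫ z ∈ˢ Y) => ?_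
  refine bexE (h₃' hz) fun Ξ _ R hR
    (h : Ξ ⊫ ball R (rel (L + 1) 0 (p + 1)) ∧ˢ isTag T P z R D) => ?_
  have : Ξ ⊩ hasTag B L P T Y p D := exI R (both (basicI hc hR (fst h)) (bexI z hzY (snd h)))
  exact this

theorem isTag_unique {T P z z' R D : ℕ} (h : Γ ⊫ isTag T P z R D) (h' : Γ ⊫ isTag T P z' R D) :
    Γ ⊩ z =ˢ z' := by
  refine isTagE h fun _ _ t _ ht hz => isTagE h' fun Δ _ t' _ ht' hz' => ?_
  have e : Δ ⊫ isOPair z P t' := subst (isOPair (z + 1) (P + 1) 0) (opair_unique ht ht') hz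
  exact opair_unique e hz'

/-- The rule {tag of (R, D)} → {p} × D, which forces a tag to keep its promise at p. -/
theorem ruled_tag {R D p : ℕ} (hC : Carrier Γ P L B Q L' B' U V T X)
    (hR : Γ ⊫ R ∈ˢ U) (hD : Γ ⊫ D ∈ˢ V) (hp : Γ ⊫ p ∈ˢ R) :
    Γ ⊩ ruled X (validRule X (morphismExt P L K Q L' K' U V T X))
      (bex 0 (isTag (T + 2) (P + 2) 0 (R + 2) (D + 2)) →ˢ bex (D + 1) (rel 1 (p + 2) 0)) := by
  have hpP : Γ ⊫ p ∈ˢ P := subE (hC.sub_of_mem hR) hp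
  refine hC.tagE hR hD fun _ _ z hzX hz => upairE z z fun _ _ a ha => ?_
  refine sepE (bex (D + 1) (isOPair 1 (p + 2) 0)) (.bex _ (bounded_isOPair _ _ _)) X
    fun Ω _ b h₁ h₂ h₃ => ?_
  have h₃' : ∀ {Θ : List Fm} [Le Ω Θ] {x : ℕ}, (Θ ⊩ x ∈ˢ b) →
    Θ ⊩ bex D (isOPair (x + 1) (p + 1) 0) := fun h => h₃ h
  have h : Ω ⊫ ruled X (validRule X (morphismExt P L K Q L' K' U V T X))
      (sub (a + 1) 0 →ˢ bex (b + 1) (0 ∈ˢ 1)) :=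
    ruled_rule (singleton_sub ha hzX) (subI fun _ _ x hx => h₂ hx)
      fun _ _ Y hY haY => morphismExtE hY fun Δ _ F hM hF => by
        refine bexE (rel_of_tag_mem_ext hM hF hz (subE haY (fst ha)) hp) fun Θ _ q hq
          (hpq : Θ ⊫ rel F p q) => ?_
        refine opairE p q fun Ξ _ w hw => ?_
        have hqQ : Ξ ⊫ q ∈ˢ Q := subE (hC.sub_of_mem' hD) hq
        refine bexI w (h₁ (hC.pair_mem hpP hqQ hw) (bexI q hq hw)) ?_
        exact mem_of_rel (Carrier.rel_ext hC.mono hF hpP hqQ hpq) hw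
  refine ruled_mono h fun Δ _ Y _ (hY : Δ ⊫ sub a Y →ˢ bex b (0 ∈ˢ Y + 1)) => ?_
  refine impI fun Θ _ (hzY : Θ ⊫ bex Y (isTag (T + 1) (P + 1) 0 (R + 1) (D + 1))) => ?_
  refine bexE hzY fun _ _ z' hz'Y hz' => ?_
  refine bexE (mp hY (singleton_sub ha (mem_of_eq (isTag_unique hz' hz) hz'Y)))
    fun _ _ w hw (hwY : _ ⊫ w ∈ˢ Y) => ?_
  refine bexE (h₃' hw) fun Ξ _ q hq (hwq : Ξ ⊫ isOPair w p q) => ?_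
  have : Ξ ⊩ bex D (rel (Y + 1) (p + 1) 0) := bexI q hq (relI hwY hwq)
  exact this

/-! ### The subsets of the carrier that are closed under the rules -/

/-- `Y` is closed under the order relations. -/
def isUpward (Y P L Q L' : ℕ) : Fm :=
  ball P (ball (P + 1) (ball (Q + 2) (ball (Q + 3)
    (rel (L + 4) 2 3 →ˢ rel (L' + 4) 1 0 →ˢ rel (Y + 4) 3 1 →ˢ rel (Y + 4) 2 0))))

/-- `Y` is closed under basic covers. -/
def isLocal (Y P L B Q : ℕ) : Fm :=
  ball P (ball (Q + 1) (.all (basic (B + 3) (L + 3) 2 0 →ˢ ball 0 (rel (Y + 4) 0 2) →ˢ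
    rel (Y + 3) 2 1)))

/-- The tags that correspond to the totality of a morphism. -/
def tagsTotal (Y P L B Q T : ℕ) : Fm :=
  ball P (hasTag (B + 1) (L + 1) (P + 1) (T + 1) (Y + 1) 0 (Q + 1))

/-- The tags that correspond to the preservation of meets. -/
def tagsMeet (Y P L B Q L' V T : ℕ) : Fm :=
  ball P (ball (Q + 1) (ball (Q + 2) (rel (Y + 3) 2 1 →ˢ rel (Y + 3) 2 0 →ˢ
    bex (V + 3) (isMeet 0 2 1 (Q + 4) (L' + 4) ∧ˢ
      hasTag (B + 4) (L + 4) (P + 4) (T + 4) (Y + 4) 3 0))))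

/-- The tags that correspond to the preservation of covers. -/
def tagsCover (Y P L B Q L' B' T : ℕ) : Fm :=
  ball P (ball (Q + 1) (rel (Y + 2) 1 0 →ˢ .all (basic (B' + 3) (L' + 3) 1 0 →ˢ
    hasTag (B + 3) (L + 3) (P + 3) (T + 3) (Y + 3) 2 0)))

/-- The meaning of the tags. -/
def tagsSound (Y P U V T : ℕ) : Fm :=
  ball U (ball (V + 1) (ball 1 (bex (Y + 3) (isTag (T + 4) (P + 4) 0 3 2) →ˢ
    bex 1 (rel (Y + 4) 1 0))))

theorem ruled_isUpward (hC : Carrier Γ P L B Q L' B' U V T X) :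
    Γ ⊩ ruled X (validRule X (morphismExt P L K Q L' K' U V T X))
      (isUpward 0 (P + 1) (L + 1) (Q + 1) (L' + 1)) := by
  refine ruled_ball fun _ _ p hp => ruled_ball fun _ _ p' hp' => ruled_ball fun _ _ q hq =>
    ruled_ball fun Δ _ q' hq' => ?_
  have h : Δ ⊩ ruled X (validRule X (morphismExt P L K Q L' K' U V T X))
      ((rel L p' p).shift →ˢ (rel L' q q').shift →ˢ
        rel 0 (p + 1) (q + 1) →ˢ rel 0 (p' + 1) (q' + 1)) :=
    ruled_imp (bounded_rel _ _ _) fun _ _ hl => ruled_imp (bounded_rel _ _ _) fun _ _ hl' =>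
      ruled_upward hC.mono hp hp' hq hq' hl hl'
  exact h

theorem ruled_isLocal (hP : Presented Γ P L B K) (hQ : Presented Γ Q L' B' K')
    (hC : Carrier Γ P L B Q L' B' U V T X) :
    Γ ⊩ ruled X (validRule X (morphismExt P L K Q L' K' U V T X))
      (isLocal 0 (P + 1) (L + 1) (B + 1) (Q + 1)) := by
  refine ruled_ball fun _ _ p hp => ruled_ball fun Δ _ q hq => ?_
  -- The quantifier over basic covers of p becomes one over the set c = B(p), with the condition of
  -- lying below p as a bounded premise for `ruled_imp`.
  refine isFun_total hP.isFun hp fun Θ _ c hc => ?_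
  have h : Θ ⊩ ruled X (validRule X (morphismExt P L K Q L' K' U V T X))
      (ball (c + 1) (ball 0 (rel (L + 3) 0 (p + 3)) →ˢ ball 0 (rel 2 0 (q + 3)) →ˢ
        rel 1 (p + 2) (q + 2))) := by
    refine ruled_ball fun Ξ _ R hR => ?_
    have h : Ξ ⊩ ruled X (validRule X (morphismExt P L K Q L' K' U V T X))
        ((ball R (rel (L + 1) 0 (p + 1))).shift →ˢ ball (R + 1) (rel 1 0 (q + 2)) →ˢ
          rel 0 (p + 1) (q + 1)) :=
      ruled_imp (.ball _ (bounded_rel _ _ _)) fun _ _ hl =>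
        ruled_local hP.mono hQ.mono hC.mono hp hq (basicI hc hR hl)
    exact h
  refine ruled_mono h fun Ξ _ Y _ (hY : Ξ ⊫ ball c (ball 0 (rel (L + 2) 0 (p + 2)) →ˢ
    ball 0 (rel (Y + 2) 0 (q + 2)) →ˢ rel (Y + 1) (p + 1) (q + 1))) => ?_
  refine allI fun R => impI fun Δ' _ (hR : Δ' ⊫ basic B L p R) => ?_
  refine basicE hR fun Ω _ c' hc' hRc' hle => ?_
  have h₁ : Ω ⊩ ball R (rel (L + 1) 0 (p + 1)) →ˢ ball R (rel (Y + 1) 0 (q + 1)) →ˢ rel Y p q :=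
    ballE hY (mem_of_mem_eq (isFun_unique hP.isFun hp hc' hc) hRc')
  exact mp h₁ hle

theorem ruled_tagsTotal (hP : Presented Γ P L B K) (hC : Carrier Γ P L B Q L' B' U V T X) :
    Γ ⊩ ruled X (validRule X (morphismExt P L K Q L' K' U V T X))
      (tagsTotal 0 (P + 1) (L + 1) (B + 1) (Q + 1) (T + 1)) := by
  refine ruled_ball fun _ _ p hp => ?_
  -- Totality has no premise, so the rule starts from the empty set.
  refine sepE .bot .bot X fun Δ _ a _ _ ha => ?_
  have ha' : ∀ {Θ : List Fm} [Le Δ Θ] {x : ℕ} {χ : Fm}, (Θ ⊩ x ∈ˢ a) → Θ ⊩ χ :=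
    fun h => .botE (ha h)
  have h : Δ ⊩ ruled X (validRule X (morphismExt P L K Q L' K' U V T X))
      (sub (a + 1) 0 →ˢ hasTag (B + 1) (L + 1) (P + 1) (T + 1) 0 (p + 1) (Q + 1)) :=
    ruled_hasTag hP.mono hC.mono hp hC.self_mem (subI fun _ _ _ hx => ha' hx)
      fun _ _ F Y hM _ _ => morphism_total hP.mono hM hp
  refine ruled_mono h fun Θ _ Y _ (hY : Θ ⊫ sub a Y →ˢ hasTag B L P T Y p Q) => ?_
  have h' : Θ ⊩ hasTag B L P T Y p Q := mp hY (subI fun _ _ _ hx => ha' hx)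
  exact h'

theorem ruled_tagsMeet (hP : Presented Γ P L B K) (hC : Carrier Γ P L B Q L' B' U V T X) :
    Γ ⊩ ruled X (validRule X (morphismExt P L K Q L' K' U V T X))
      (tagsMeet 0 (P + 1) (L + 1) (B + 1) (Q + 1) (L' + 1) (V + 1) (T + 1)) := by
  refine ruled_ball fun _ _ p hp => ruled_ball fun _ _ q₀ hq₀ => ruled_ball fun _ _ q₁ hq₁ => ?_
  refine bexE (hC.meet_mem hq₀ hq₁) fun _ _ D hDV (hD : _ ⊫ isMeet D q₀ q₁ Q L') => ?_
  refine opairE p q₀ fun _ _ z₀ hz₀ => opairE p q₁ fun _ _ z₁ hz₁ => ?_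
  -- The premise of the rule is {(p, q₀), (p, q₁)}.
  refine upairE z₀ z₁ fun Δ _ a ha => ?_
  have hsub : ∀ {Θ : List Fm} [Le Δ Θ] {A : ℕ}, (Θ ⊫ z₀ ∈ˢ A) → (Θ ⊫ z₁ ∈ˢ A) → Θ ⊩ sub a A :=
    fun h₀ h₁ => subI fun _ _ x hx => orE (upairCases ha hx)
      (fun _ _ e => mem_of_eq (symm e) h₀) (fun _ _ e => mem_of_eq (symm e) h₁)
  have h : Δ ⊩ ruled X (validRule X (morphismExt P L K Q L' K' U V T X))
      (sub (a + 1) 0 →ˢ hasTag (B + 1) (L + 1) (P + 1) (T + 1) 0 (p + 1) (D + 1)) :=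
    ruled_hasTag hP.mono hC.mono hp hDV (hsub (hC.pair_mem hp hq₀ hz₀) (hC.pair_mem hp hq₁ hz₁))
      fun _ _ F Y hM hF haY => morphism_meet hP.mono hM hp hq₀ hq₁
        (rel_of_rel_ext hF hp (relI (subE haY (fst ha)) hz₀))
        (rel_of_rel_ext hF hp (relI (subE haY (fst (snd ha))) hz₁)) hD
  refine ruled_mono h fun Ω _ Y _ (hY : Ω ⊫ sub a Y →ˢ hasTag B L P T Y p D) => ?_
  have h' : Ω ⊩ rel Y p q₀ →ˢ rel Y p q₁ →ˢ bex V (isMeet 0 (q₀ + 1) (q₁ + 1) (Q + 1) (L' + 1) ∧ˢ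
      hasTag (B + 1) (L + 1) (P + 1) (T + 1) (Y + 1) (p + 1) 0) :=
    impI fun _ _ h₀ => impI fun Θ _ h₁ => by
      have h₂ : Θ ⊩ hasTag B L P T Y p D := mp hY (hsub (mem_of_rel h₀ hz₀) (mem_of_rel h₁ hz₁))
      exact bexI D hDV (both hD h₂)
  exact h'

theorem ruled_tagsCover (hP : Presented Γ P L B K) (hQ : Presented Γ Q L' B' K')
    (hC : Carrier Γ P L B Q L' B' U V T X) :
    Γ ⊩ ruled X (validRule X (morphismExt P L K Q L' K' U V T X))
      (tagsCover 0 (P + 1) (L + 1) (B + 1) (Q + 1) (L' + 1) (B' + 1) (T + 1)) := by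
  refine ruled_ball fun _ _ p hp => ruled_ball fun _ _ q hq => ?_
  refine isFun_total hQ.isFun hq fun _ _ c hc => ?_
  refine opairE p q fun _ _ z hz => upairE z z fun Δ _ a ha => ?_
  have h : Δ ⊩ ruled X (validRule X (morphismExt P L K Q L' K' U V T X))
      (ball (c + 1) (ball 0 (rel (L' + 3) 0 (q + 3)) →ˢ sub (a + 2) 1 →ˢ
        hasTag (B + 2) (L + 2) (P + 2) (T + 2) 1 (p + 2) 0)) := by
    refine ruled_ball fun Ξ _ D hD => ?_
    have h : Ξ ⊩ ruled X (validRule X (morphismExt P L K Q L' K' U V T X))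
        ((ball D (rel (L' + 1) 0 (q + 1))).shift →ˢ sub (a + 1) 0 →ˢ
          hasTag (B + 1) (L + 1) (P + 1) (T + 1) 0 (p + 1) (D + 1)) := by
      refine ruled_imp (.ball _ (bounded_rel _ _ _)) fun Ω _ hl => ?_
      have hD' : Ω ⊫ basic B' L' q D := basicI hc hD hl
      have hDV : Ω ⊫ D ∈ˢ V := hC.basic_mem' hq hD'
      exact ruled_hasTag hP.mono hC.mono hp hDV (singleton_sub ha (hC.pair_mem hp hq hz))
        fun _ _ F Y hM hF haY => morphism_cover hP.mono hQ.mono hM hp hq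
          (rel_of_rel_ext hF hp (relI (subE haY (fst ha)) hz)) hD' (hC.sub_of_mem' hDV)
    exact h
  refine ruled_mono h fun Ω _ Y _ (hY : Ω ⊫ ball c (ball 0 (rel (L' + 2) 0 (q + 2)) →ˢ
    sub (a + 1) (Y + 1) →ˢ hasTag (B + 1) (L + 1) (P + 1) (T + 1) (Y + 1) (p + 1) 0)) => ?_
  refine impI fun _ _ (hpq : _ ⊫ rel Y p q) => allI fun D => impI fun _ _
    (hD : _ ⊫ basic B' L' q D) => ?_
  refine basicE hD fun Θ _ c' hc' hDc' hle => ?_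
  have h₁ : Θ ⊩ ball D (rel (L' + 1) 0 (q + 1)) →ˢ sub a Y →ˢ hasTag B L P T Y p D :=
    ballE hY (mem_of_mem_eq (isFun_unique hQ.isFun hq hc' hc) hDc')
  have h₂ : Θ ⊩ hasTag B L P T Y p D := mp (mp h₁ hle) (singleton_sub ha (mem_of_rel hpq hz))
  exact h₂

theorem ruled_tagsSound (hC : Carrier Γ P L B Q L' B' U V T X) :
    Γ ⊩ ruled X (validRule X (morphismExt P L K Q L' K' U V T X))
      (tagsSound 0 (P + 1) (U + 1) (V + 1) (T + 1)) := by
  refine ruled_ball fun _ _ R hR => ruled_ball fun _ _ D hD => ruled_ball fun Δ _ p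
    (hp : Δ ⊫ p ∈ˢ R) => ?_
  have h : Δ ⊩ ruled X (validRule X (morphismExt P L K Q L' K' U V T X))
      (bex 0 (isTag (T + 2) (P + 2) 0 (R + 2) (D + 2)) →ˢ bex (D + 1) (rel 1 (p + 2) 0)) :=
    ruled_tag hC.mono hR hD hp
  exact h

/-! ### From closed subsets of the carrier to morphisms -/

/-- `F = Y ∩ (P × Q)`. -/
def isRelPart (F Y P Q : ℕ) : Fm :=
  .all (0 ∈ˢ F + 1 ↔ˢ 0 ∈ˢ Y + 1 ∧ˢ bex (P + 1) (bex (Q + 2) (isOPair 2 1 0)))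

theorem isRelPartE (Y P Q : ℕ) {χ : Fm} (k : ∀ Δ [Le Γ Δ] F, (Δ ⊫ isRelPart F Y P Q) → Δ ⊩ χ) :
    Γ ⊩ χ := by
  refine sepE (bex (P + 1) (bex (Q + 2) (isOPair 2 1 0))) (.bex _ (.bex _ (bounded_isOPair _ _ _)))
    Y fun Δ _ F h₁ h₂ h₃ => k Δ F ?_
  intro Ω _
  refine allI fun z => both (impI fun _ _ hz => both (h₂ hz) (h₃ hz)) (impI fun Θ _ hz => ?_)
  have h : Θ ⊩ z ∈ˢ Y ∧ˢ (bex (P + 1) (bex (Q + 2) (isOPair 2 1 0))).inst z := hz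
  exact h₁ (fst h) (snd h)

theorem isRelPart_sub (h : Γ ⊫ isRelPart F Y P Q) : Γ ⊩ sub F Y :=
  subI fun _ _ z hz => fst (mp (fst (allE h z)) hz)

theorem mem_relPart {z p q : ℕ} (h : Γ ⊩ isRelPart F Y P Q) (hz : Γ ⊩ z ∈ˢ Y) (hp : Γ ⊩ p ∈ˢ P)
    (hq : Γ ⊩ q ∈ˢ Q) (hpq : Γ ⊩ isOPair z p q) : Γ ⊩ z ∈ˢ F :=
  mp (snd (allE h z)) (both hz (bexI p hp (bexI q hq hpq)))

theorem rel_relPart {p q : ℕ} (h : Γ ⊫ isRelPart F Y P Q) (hp : Γ ⊫ p ∈ˢ P)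
    (hq : Γ ⊫ q ∈ˢ Q) (hpq : Γ ⊫ rel Y p q) : Γ ⊩ rel F p q :=
  relE hpq fun _ _ _ hz hpq => relI (mem_relPart h hz hp hq hpq) hpq

theorem isUpwardE {p p' q q' : ℕ} (h : Γ ⊫ isUpward Y P L Q L') (hp : Γ ⊫ p ∈ˢ P)
    (hp' : Γ ⊫ p' ∈ˢ P) (hq : Γ ⊫ q ∈ˢ Q) (hq' : Γ ⊫ q' ∈ˢ Q) (hl : Γ ⊫ rel L p' p)
    (hl' : Γ ⊫ rel L' q q') (hpq : Γ ⊫ rel Y p q) : Γ ⊩ rel Y p' q' := by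
  have h₁ : Γ ⊩ ball P (ball (Q + 1) (ball (Q + 2) (rel (L + 3) 2 (p + 3) →ˢ
    rel (L' + 3) 1 0 →ˢ rel (Y + 3) (p + 3) 1 →ˢ rel (Y + 3) 2 0))) := ballE h hp
  have h₂ : Γ ⊩ ball Q (ball (Q + 1) (rel (L + 2) (p' + 2) (p + 2) →ˢ
    rel (L' + 2) 1 0 →ˢ rel (Y + 2) (p + 2) 1 →ˢ rel (Y + 2) (p' + 2) 0)) := ballE h₁ hp'
  have h₃ : Γ ⊩ ball Q (rel (L + 1) (p' + 1) (p + 1) →ˢ rel (L' + 1) (q + 1) 0 →ˢ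
    rel (Y + 1) (p + 1) (q + 1) →ˢ rel (Y + 1) (p' + 1) 0) := ballE h₂ hq
  have h₄ : Γ ⊩ rel L p' p →ˢ rel L' q q' →ˢ rel Y p q →ˢ rel Y p' q' := ballE h₃ hq'
  exact mp (mp (mp h₄ hl) hl') hpq

theorem isLocalE {p q R : ℕ} (h : Γ ⊫ isLocal Y P L B Q) (hp : Γ ⊫ p ∈ˢ P) (hq : Γ ⊫ q ∈ˢ Q)
    (hR : Γ ⊫ basic B L p R) (hY : Γ ⊫ ball R (rel (Y + 1) 0 (q + 1))) : Γ ⊩ rel Y p q := by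
  have h₁ : Γ ⊩ ball Q (.all (basic (B + 2) (L + 2) (p + 2) 0 →ˢ ball 0 (rel (Y + 3) 0 2) →ˢ
    rel (Y + 2) (p + 2) 1)) := ballE h hp
  have h₂ : Γ ⊩ .all (basic (B + 1) (L + 1) (p + 1) 0 →ˢ ball 0 (rel (Y + 2) 0 (q + 2)) →ˢ
    rel (Y + 1) (p + 1) (q + 1)) := ballE h₁ hq
  have h₃ : Γ ⊩ basic B L p R →ˢ ball R (rel (Y + 1) 0 (q + 1)) →ˢ rel Y p q := allE h₂ R
  exact mp (mp h₃ hR) hY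

theorem tagsSoundE {R D p : ℕ} (h : Γ ⊫ tagsSound Y P U V T) (hR : Γ ⊫ R ∈ˢ U) (hD : Γ ⊫ D ∈ˢ V)
    (hp : Γ ⊫ p ∈ˢ R) (hz : Γ ⊫ bex Y (isTag (T + 1) (P + 1) 0 (R + 1) (D + 1))) :
    Γ ⊩ bex D (rel (Y + 1) (p + 1) 0) := by
  have h₁ : Γ ⊩ ball V (ball (R + 1) (bex (Y + 2) (isTag (T + 3) (P + 3) 0 (R + 3) 2) →ˢ
    bex 1 (rel (Y + 3) 1 0))) := ballE h hR
  have h₂ : Γ ⊩ ball R (bex (Y + 1) (isTag (T + 2) (P + 2) 0 (R + 2) (D + 2)) →ˢ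
    bex (D + 1) (rel (Y + 2) 1 0)) := ballE h₁ hD
  have h₃ : Γ ⊩ bex Y (isTag (T + 1) (P + 1) 0 (R + 1) (D + 1)) →ˢ
    bex D (rel (Y + 1) (p + 1) 0) := ballE h₂ hp
  exact mp h₃ hz

/-- If `Y` contains the tag of `(R, D)` for some basic cover `R` of `p`, then `p` has a cover `S`
such that each `x ∈ S` is related by `Y` to some `q ∈ D`. -/
theorem hasTagE {p D : ℕ} {χ : Fm} (hP : Presented Γ P L B K) (hQ : Presented Γ Q L' B' K')
    (hC : Carrier Γ P L B Q L' B' U V T X) (hup : Γ ⊫ isUpward Y P L Q L')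
    (hs : Γ ⊫ tagsSound Y P U V T) (hF : Γ ⊫ isRelPart F Y P Q) (hp : Γ ⊫ p ∈ˢ P)
    (hD : Γ ⊫ D ∈ˢ V) (h : Γ ⊫ hasTag B L P T Y p D)
    (k : ∀ Δ [Le Γ Δ] S, (Δ ⊫ K.app₂ 0 p S) →
      (Δ ⊫ ball S (bex (D + 1) (rel (F + 2) 1 0))) → Δ ⊩ χ) : Γ ⊩ χ := by
  refine exE h fun Δ _ R (hR : Δ ⊫ basic B L p R ∧ˢ
    bex Y (isTag (T + 1) (P + 1) 0 (R + 1) (D + 1))) => ?_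
  have hR' : Δ ⊫ basic B L p R := fst hR
  have hRU : Δ ⊫ R ∈ˢ U := hC.basic_mem hp hR'
  refine Presented.coverE (Γ := Δ) hP.mono hp hR' fun Θ _ S hS hSP hS' => k Θ S hS ?_
  intro Θ' _
  refine ballI fun _ _ x hx => bexE (hS' hx) fun Ξ _ r hr (hxr : Ξ ⊫ rel L x r) => ?_
  refine bexE (tagsSoundE (Γ := Ξ) hs hRU hD hr (snd hR)) fun Ω _ q hq (hrq : Ω ⊫ rel Y r q) => ?_
  have hqQ : Ω ⊫ q ∈ˢ Q := subE (hC.sub_of_mem' hD) hq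
  have hrP : Ω ⊫ r ∈ˢ P := subE (hC.sub_of_mem hRU) hr
  have hxP : Ω ⊫ x ∈ˢ P := hSP hx
  have h₁ : Ω ⊫ rel Y x q := isUpwardE hup hrP hxP hqQ hqQ hxr (le_refl hQ.preorder hqQ) hrq
  have h₂ : Ω ⊩ bex D (rel (F + 1) (x + 1) 0) := bexI q hq (rel_relPart hF hxP hqQ h₁)
  exact h₂

/-- For (3)–(5), closure puts the tag of some (R, D) into Y, soundness of tags relates each r ∈ R to
an element of D, and monotonicity extends this to the sieve generated by R. Condition (2) reduces to
a basic cover inside the given one. -/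
theorem isMorphism_of_closed (hP : Presented Γ P L B K) (hQ : Presented Γ Q L' B' K')
    (hC : Carrier Γ P L B Q L' B' U V T X) (hup : Γ ⊫ isUpward Y P L Q L')
    (hlocal : Γ ⊫ isLocal Y P L B Q) (htotal : Γ ⊫ tagsTotal Y P L B Q T)
    (hmeet : Γ ⊫ tagsMeet Y P L B Q L' V T) (hcover : Γ ⊫ tagsCover Y P L B Q L' B' T)
    (hs : Γ ⊫ tagsSound Y P U V T) (hF : Γ ⊫ isRelPart F Y P Q) :
    Γ ⊩ isMorphism 0 F P L K Q L' K' := by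
  have hFY : Γ ⊫ sub F Y := isRelPart_sub hF
  refine both ?_ (both ?_ (both ?_ (both ?_ (both ?_ ?_))))
  · exact ballI fun _ _ z hz => snd (mp (fst (allE hF z)) hz)
  · refine ballI fun _ _ p hp => ballI fun _ _ p' hp' => ballI fun _ _ q hq => ballI fun _ _ q' hq' =>
      impI fun _ _ (hpq : _ ⊫ rel F p q) => impI fun _ _ (hl : _ ⊫ rel L p' p) =>
      impI fun Δ _ (hl' : Δ ⊫ rel L' q q') => ?_
    have h₁ : Δ ⊫ rel Y p' q' := isUpwardE hup hp hp' hq hq' hl hl' (rel_sub hpq hFY)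
    have h₂ : Δ ⊩ rel F p' q' := rel_relPart hF hp' hq' h₁
    exact h₂
  · refine ballI fun _ _ q hq => ballI fun _ _ p hp => allI fun S => impI fun Ω _ hS => ?_
    have hK : Ω ⊫ K.app₂ 0 p S := by
      intro Θ _
      convert! hS (Θ := Θ) using 1
      simp only [Fm.app₂, Fm.ren_ren]
      congr 1; funext n; rcases n with _ | _ | n <;> rfl
    refine impI fun Δ _ (hSF : Δ ⊫ ball S (rel (F + 1) 0 (q + 1))) => ?_
    refine Presented.basicE (Γ := Δ) hP.mono hp hK fun Θ _ R hR hRS => ?_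
    have h₁ : Θ ⊫ ball R (rel (Y + 1) 0 (q + 1)) := ballI fun Ξ _ r hr => by
      have h₂ : Ξ ⊫ rel F r q := ballE hSF (subE hRS hr)
      have h₃ : Ξ ⊩ rel Y r q := rel_sub h₂ hFY
      exact h₃
    have h₄ : Θ ⊩ rel F p q := rel_relPart hF hp hq (isLocalE hlocal hp hq hR h₁)
    exact h₄
  · refine ballI fun Δ _ p hp => ?_
    have h : Δ ⊫ hasTag B L P T Y p Q := ballE htotal hp
    refine hasTagE (Γ := Δ) hP.mono hQ.mono hC.mono hup hs hF hp hC.self_mem h fun Θ _ S hK hS =>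
      exI S (both ?_ hS)
    convert! hK (Θ := Θ) using 1
    simp only [Fm.app₂, Fm.ren_ren]
    congr 1; funext n; rcases n with _ | _ | n <;> rfl
  · refine ballI fun _ _ q₀ hq₀ => ballI fun _ _ q₁ hq₁ => ballI fun _ _ p hp =>
      impI fun _ _ (h₀ : _ ⊫ rel F p q₀) => impI fun Δ _ (h₁ : Δ ⊫ rel F p q₁) => ?_
    have h₂ : Δ ⊩ ball Q (ball (Q + 1) (rel (Y + 2) (p + 2) 1 →ˢ rel (Y + 2) (p + 2) 0 →ˢ
      bex (V + 2) (isMeet 0 2 1 (Q + 3) (L' + 3) ∧ˢ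
        hasTag (B + 3) (L + 3) (P + 3) (T + 3) (Y + 3) (p + 3) 0))) := ballE hmeet hp
    have h₃ : Δ ⊩ ball Q (rel (Y + 1) (p + 1) (q₀ + 1) →ˢ rel (Y + 1) (p + 1) 0 →ˢ
      bex (V + 1) (isMeet 0 (q₀ + 2) 1 (Q + 2) (L' + 2) ∧ˢ
        hasTag (B + 2) (L + 2) (P + 2) (T + 2) (Y + 2) (p + 2) 0)) := ballE h₂ hq₀
    have h₄ : Δ ⊩ rel Y p q₀ →ˢ rel Y p q₁ →ˢ
      bex V (isMeet 0 (q₀ + 1) (q₁ + 1) (Q + 1) (L' + 1) ∧ˢ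
        hasTag (B + 1) (L + 1) (P + 1) (T + 1) (Y + 1) (p + 1) 0) := ballE h₃ hq₁
    refine bexE (mp (mp h₄ (rel_sub h₀ hFY)) (rel_sub h₁ hFY)) fun Θ _ D hDV
      (hD : Θ ⊫ isMeet D q₀ q₁ Q L' ∧ˢ hasTag B L P T Y p D) => ?_
    refine hasTagE (Γ := Θ) hP.mono hQ.mono hC.mono hup hs hF hp hDV (snd hD) fun Θ _ S hK hS =>
      exI S (both ?_ (ballI fun Ξ _ x hx => ?_))
    · convert! hK (Θ := Θ) using 1
      simp only [Fm.app₂, Fm.ren_ren]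
      congr 1; funext n; rcases n with _ | _ | n <;> rfl
    · have h₅ : Ξ ⊩ bex D (rel (F + 1) (x + 1) 0) := ballE hS hx
      refine bexE h₅ fun Ω _ q hq (hxq : Ω ⊫ rel F x q) => ?_
      have h₆ : Ω ⊩ q ∈ˢ Q ∧ˢ rel L' q q₀ ∧ˢ rel L' q q₁ := mp (fst (allE (fst hD) q)) hq
      exact bexI q (fst h₆) (both hxq (snd h₆))
  · refine ballI fun _ _ p hp => ballI fun _ _ q hq => impI fun _ _ (hpq : _ ⊫ rel F p q) =>
      allI fun D' => impI fun Δ _ hD' => ?_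
    have hK' : Δ ⊫ K'.app₂ 0 q D' := by
      intro Θ _
      convert! hD' (Θ := Θ) using 1
      simp only [Fm.app₂, Fm.ren_ren]
      congr 1; funext n; rcases n with _ | _ | n <;> rfl
    -- The tags deal only with basic covers of q, so one contained in the given cover is used.
    refine Presented.basicE (Γ := Δ) hQ.mono hq hK' fun Ω _ D hD hDD' => ?_
    have h₂ : Ω ⊩ ball Q (rel (Y + 1) (p + 1) 0 →ˢ .all (basic (B' + 2) (L' + 2) 1 0 →ˢ
      hasTag (B + 2) (L + 2) (P + 2) (T + 2) (Y + 2) (p + 2) 0)) := ballE hcover hp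
    have h₃ : Ω ⊩ rel Y p q →ˢ .all (basic (B' + 1) (L' + 1) (q + 1) 0 →ˢ
      hasTag (B + 1) (L + 1) (P + 1) (T + 1) (Y + 1) (p + 1) 0) := ballE h₂ hq
    have h₄ : Ω ⊩ basic B' L' q D →ˢ hasTag B L P T Y p D :=
      allE (mp h₃ (rel_sub hpq hFY)) D
    have h₅ : Ω ⊫ hasTag B L P T Y p D := stable (mp h₄ hD)
    refine hasTagE (Γ := Ω) hP.mono hQ.mono hC.mono hup hs hF hp (hC.basic_mem' hq hD) h₅
      fun Θ _ S hK hS => exI S (both ?_ (ballI fun Ξ _ x hx => ?_))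
    · convert! hK (Θ := Θ) using 1
      simp only [Fm.app₂, Fm.ren_ren]
      congr 1; funext n; rcases n with _ | _ | n <;> rfl
    · have h₆ : Ξ ⊩ bex D (rel (F + 1) (x + 1) 0) := ballE hS hx
      refine bexE h₆ fun Ω _ q hq (hxq : Ω ⊫ rel F x q) => bexI q (subE hDD' hq) hxq

/-! ### The theorem -/

theorem isMorphism_app_inst {G : ℕ} :
    (((isMorphism 1 0 (P + 1) (L + 1) K (Q + 1) (L' + 1) K').app₁ 2 0).ren
      (liftRen (instRen G))).ren (instRen F) = isMorphism 0 F P L K Q L' K' := by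
  have e : (isMorphism 1 0 (P + 1) (L + 1) K (Q + 1) (L' + 1) K').app₁ 2 0 =
      isMorphism 2 0 (P + 2) (L + 2) K (Q + 2) (L' + 2) K' :=
    isMorphism_ren _ _ _ _ _ _ _ fun _ => rfl
  rw [e, isMorphism_inst_inst]

theorem setGenerated_of_presented (hN : Γ ⊫ NID) (hP : Presented Γ P L B K)
    (hQ : Presented Γ Q L' B' K') :
    Γ ⊩ setGenerated (isMorphism 1 0 (P + 1) (L + 1) K (Q + 1) (L' + 1) K') := by
  refine carrierE hP hQ fun Ω _ U V T X hC => ?_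
  have hP' : Presented Ω P L B K := hP.mono
  have hQ' : Presented Ω Q L' B' K' := hQ.mono
  have h : Ω ⊩ ruled X (validRule X (morphismExt P L K Q L' K' U V T X)) _ :=
    ruled_and (ruled_isUpward hC.mono) (ruled_and (ruled_isLocal hP'.mono hQ'.mono hC.mono)
    (ruled_and (ruled_tagsTotal hP'.mono hC.mono) (ruled_and (ruled_tagsMeet hP'.mono hC.mono)
      (ruled_and (ruled_tagsCover hP'.mono hQ'.mono hC.mono) (ruled_tagsSound hC.mono)))))
  refine ruled_generates hN h fun Ω _ C hCX hCH hCG => ?_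
  -- The generating set consists of restrictions Y ∩ (P × Q) of the closed sets Y ∈ C.
  refine collE (isRelPart 1 0 (P + 2) (Q + 2)) C (fun _ _ Y _ => isRelPartE Y P Q fun _ _ F hF =>
    exI F hF) fun Ω _ G hG hG' => exI G (both (ballI fun Δ _ F hF => ?_) (allI fun F => ?_))
  · have h₁ : Δ ⊩ isMorphism 0 F P L K Q L' K' := by
      refine bexE (hG' hF) fun Ξ _ Y hY (hFY : Ξ ⊫ isRelPart F Y P Q) => ?_
      have h₂ : Ξ ⊫ isUpward Y P L Q L' ∧ˢ isLocal Y P L B Q ∧ˢ tagsTotal Y P L B Q T ∧ˢ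
        tagsMeet Y P L B Q L' V T ∧ˢ tagsCover Y P L B Q L' B' T ∧ˢ tagsSound Y P U V T := hCH hY
      exact isMorphism_of_closed (Γ := Ξ) hP.mono hQ.mono hC.mono (fst h₂) (fst (snd h₂))
        (fst (snd (snd h₂))) (fst (snd (snd (snd h₂)))) (fst (snd (snd (snd (snd h₂)))))
        (snd (snd (snd (snd (snd h₂))))) hFY
    rw [← isMorphism_app_inst (G := G)] at h₁
    exact h₁
  · refine impI fun Δ _ hM => ?_
    have hM : Δ ⊫ isMorphism 0 F P L K Q L' K' := by
      intro Θ _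
      rw [← isMorphism_app_inst (G := G)]
      exact hM
    have h₁ : Δ ⊩ ball F (bex (G + 1) (1 ∈ˢ 0 ∧ˢ sub 0 (F + 2))) := by
      refine ballI fun _ _ z hz => isExtE F X P U V T fun _ _ Y hY => ?_
      refine morphism_pair hM hz fun Ξ _ p q hp hq hpq => ?_
      have hzY : Ξ ⊫ z ∈ˢ Y := mem_ext_of_mem hY (hC.pair_mem hp hq hpq) (.orI₁ hz)
      refine bexE (hCG (Y := Y) (morphismExtI hM hY) (isExt_sub hY) hzY) fun Θ _ Y' hY'
        (h₂ : Θ ⊫ z ∈ˢ Y' ∧ˢ sub Y' Y) => ?_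
      refine bexE (hG hY') fun Ξ _ F' hF' (hFY : Ξ ⊫ isRelPart F' Y' P Q) => ?_
      have h₃ : Ξ ⊩ z ∈ˢ F' ∧ˢ sub F' F := by
        -- Elements of F' are pairs in P × Q that belong to Y' ⊆ Y, and such pairs in the extension
        -- Y of F already belong to F.
        refine both (mem_relPart hFY (fst h₂) hp hq hpq) (subI fun Δ _ w hw => ?_)
        refine bexE (snd (mp (fst (allE hFY w)) hw)) fun _ _ p' hp' h => bexE h fun Δ _ q' _
          (hw' : Δ ⊫ isOPair w p' q') => ?_
        have h₄ : Δ ⊫ rel Y p' q' := relI (subE (snd h₂) (subE (isRelPart_sub hFY) hw)) hw'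
        exact mem_of_rel (rel_of_rel_ext hY hp' h₄) hw'
      exact bexI F' hF' h₃
    exact h₁

end CZF

theorem mainTheorem10 (P L Q L' : ℕ) (K K' : CZF.Fm) :
    CZF.Provable CZF.Axioms []
      (CZF.NID →ˢ
        CZF.isFormalSpace P L K ∧ˢ CZF.isSetPresented P L K →ˢ
        CZF.isFormalSpace Q L' K' ∧ˢ CZF.isSetPresented Q L' K' →ˢ
        CZF.setGenerated
          (CZF.isMorphism 1 0 (P + 1) (L + 1) K (Q + 1) (L' + 1) K')) := by
  refine CZF.impI fun _ _ hN => CZF.impI fun _ _ hP => CZF.impI fun _ _ hQ => ?_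
  refine CZF.presentedE (CZF.fst hP) (CZF.snd hP) fun _ _ B hP => ?_
  refine CZF.presentedE (CZF.fst hQ) (CZF.snd hQ) fun _ _ B' hQ => ?_
  exact CZF.setGenerated_of_presented hN hP.mono hQ
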